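/- Let $\mathcal X\subseteq\mathbb R^d$ be compact and convex, let $(\Delta,\mathbb P)$ be a probability space, let $f:\mathcal X\to\mathbb R$ be convex, and let $g_1,\dots,g_M:\mathcal X\times\Delta\to\mathbb R$ ($M\ge 1$) be measurable functions that are convex in the first argument. For finite sets $\Delta_1,\dots,\Delta_M\subseteq\Delta$ let $\mathrm{SCP}[\Delta_1,\dots,\Delta_M]$ be the program $$\min_{x\in\mathcal X} f(x)\quad\text{s.t.}\quad g_i(x,\delta)\le 0\ \text{ for all }\delta\in\Delta_i,\ i=1,\dots,M .$$ Assume that, for every finite nonempty set of scenarios and all subsets $\Delta_1,\dots,\Delta_M$ that together cover it, $\mathrm{SCP}[\Delta_1,\dots,\Delta_M]$ is feasible, its feasible region has nonempty interior, and it has a unique minimizer. For each $i$ let $V_i\subseteq\mathbb R^d$ be a linear subspace such that $g_i(x,\delta)$ depends on $x\in\mathcal X$ only through the orthogonal projection of $x$ onto $V_i$ (for instance, $V_i$ is spanned by the coordinate vectors of the decision variables that enter $g_i$). Let $\mathcal X_i$ be the projection of $\mathcal X$ onto $V_i$, and let $d_i$ be the dimension of the smallest linear subspace that contains $\mathcal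 X_i$. For $\varepsilon',\beta'\in(0,1)$ and $k\in\mathbb N$ put $$S(\varepsilon',\beta',k)=\min\Big\{N\in\mathbb N:\ \sum_{j=0}^{k-1}\binom Nj\varepsilon'^j(1-\varepsilon')^{N-j}\le\beta'\Big\}.$$ Fix $\varepsilon,\beta\in(0,1)$ and $\varepsilon_i,\beta_i\in(0,1)$ with $\sum_{i=1}^M\varepsilon_i=\varepsilon$ and $\sum_{i=1}^M\beta_i=\beta$, and integers $S_i\ge S(\varepsilon_i,\beta_i,d_i)$. Draw $S=\sum_{i=1}^M S_i$ i.i.d. samples $\delta^1,\dots,\delta^S$ from $\mathbb P$. Fix index sets $J_1,\dots,J_M$ with $|J_i|=S_i$ and $\bigcup_i J_i=\{1,\dots,S\}$ (chosen independently of the sample values), and let $\Delta_i=\{\delta^j: j\in J_i\}$. Let $x^*=x^*[\Delta_1,\dots,\Delta_M]$ be the minimizer of $\mathrm{SCP}[\Delta_1,\dots,\Delta_M]$, assumed to be a measurable function of the samples. With $g(x,\delta)=\max_{i=1,\dots,M}g_i(x,\delta)$, $$\mathbb P^S\Big[\ \mathbb P\big[g(x^*[\Delta_1,\dots,\Delta_M],\delta)>0\big]\le\varepsilon\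 \Big]\ \ge\ 1-\beta .$$ -/

import Mathlib

open MeasureTheory

namespace ScenarioProgram

/-- The decision space `ℝ^d` with its Euclidean structure. -/
abbrev Dec (d : ℕ) : Type := EuclideanSpace ℝ (Fin d)

/-- Feasible region of `SCP[D₁, …, D_M]`: the points `x ∈ X` with `g i x δ ≤ 0` for all `δ ∈ D i`
and all `i`. The constraint functions matter only on `X`. -/
def feasibleSet {d M : ℕ} {Δ : Type*} (X : Set (Dec d)) (g : Fin M → Dec d → Δ → ℝ)
    (D : Fin M → Set Δ) : Set (Dec d) :=
  {x | x ∈ X ∧ ∀ i, ∀ δ ∈ D i, g i x δ ≤ 0}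

/-- `x` is a minimizer of `SCP[D₁, …, D_M]`. -/
def IsMinimizer {d M : ℕ} {Δ : Type*} (X : Set (Dec d)) (f : Dec d → ℝ)
    (g : Fin M → Dec d → Δ → ℝ) (D : Fin M → Set Δ) (x : Dec d) : Prop :=
  x ∈ feasibleSet X g D ∧ ∀ y ∈ feasibleSet X g D, f x ≤ f y

/-- The standing assumption: for every finite nonempty list of scenarios and every collection of
subsets `D₁, …, D_M` of it that together cover it, the scenario program is feasible, its feasible
region has nonempty interior, and it has exactly one minimizer. (Feasibility is implied by
nonempty interior; it is listed to match the usual wording.) -/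
def FeasibleUnique {d M : ℕ} {Δ : Type*} (X : Set (Dec d)) (f : Dec d → ℝ)
    (g : Fin M → Dec d → Δ → ℝ) : Prop :=
  ∀ (S : ℕ), 0 < S → ∀ (δ : Fin S → Δ) (D : Fin M → Set Δ),
    (∀ i, D i ⊆ Set.range δ) → (∀ j, ∃ i, δ j ∈ D i) →
      (feasibleSet X g D).Nonempty ∧ (interior (feasibleSet X g D)).Nonempty ∧
        ∃! x, IsMinimizer X f g D x

/-- The function `h` on `X × Δ` depends on `x` only through the orthogonal projection of `x`
onto the subspace `V`. If `V` is spanned by some of the coordinate vectors, this says that `h`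
depends only on the corresponding decision variables. -/
def DependsOnlyOn {d : ℕ} {Δ : Type*} (X : Set (Dec d)) (V : Submodule ℝ (Dec d))
    (h : Dec d → Δ → ℝ) : Prop :=
  ∀ x ∈ X, ∀ y ∈ X, V.starProjection x = V.starProjection y → ∀ δ, h x δ = h y δ

/-- The domain of a constraint that depends only on the part of `x` in `V`: the projection of `X`
onto `V`. -/
def constraintDomain {d : ℕ} (X : Set (Dec d)) (V : Submodule ℝ (Dec d)) : Set (Dec d) :=
  (fun x => V.starProjection x) '' X

/-- The dimension of a set: that of the smallest linear subspace containing it. -/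
noncomputable def setDim {d : ℕ} (A : Set (Dec d)) : ℕ :=
  Module.finrank ℝ (Submodule.span ℝ A)

/-- The sample size `S(ε, β, k)`: the least `N` with
`∑_{j=0}^{k-1} (N choose j) ε^j (1-ε)^(N-j) ≤ β`. -/
noncomputable def sampleSize (ε β : ℝ) (k : ℕ) : ℕ :=
  sInf {N : ℕ | ∑ j ∈ Finset.range k, (N.choose j : ℝ) * ε ^ j * (1 - ε) ^ (N - j) ≤ β}

/-- The joint constraint function `g(x, δ) = max_i g_i(x, δ)`. -/
noncomputable def jointConstraint {d M : ℕ} [NeZero M] {Δ : Type*} (g : Fin M → Dec d → Δ → ℝ)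
    (x : Dec d) (δ : Δ) : ℝ :=
  Finset.univ.sup' Finset.univ_nonempty (fun i => g i x δ)

/-- The chance constraint `P[h(x, δ) > 0] ≤ ε`. -/
def ChanceConstraint {d : ℕ} {Δ : Type*} [MeasurableSpace Δ] (P : Measure Δ)
    (h : Dec d → Δ → ℝ) (ε : ℝ) (x : Dec d) : Prop :=
  P {δ | 0 < h x δ} ≤ ENNReal.ofReal ε

end ScenarioProgram

/-!
Bound the violation of one constraint at a time, conditionally on the samples of the other
constraints, and conclude by a union bound. In the resulting program the only varying constraint
sees the decision through a projection to dimension `k = dᵢ`, so by Helly's theorem its value is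
determined by at most `k` scenarios. Relaxing each constraint by `ρ * exp t` with an independent
random label `t`, and adding `ρ * ‖x‖ ^ 2` to the objective, makes the set of determining scenarios
almost surely unique. Padded with the scenarios of lowest label it becomes the only `k`-subset of an
`n`-sample that all other `n - k` scenarios are compatible with. Hence, if `U` is the probability
that a fresh scenario is compatible with `k` random ones, then `n.choose k * E[U ^ (n - k)] = 1` for
all `n ≥ k`. These moments identify the law of `U` as the beta distribution with parameters `1` and
`k`, so that the violation exceeds `ε` with probability at most
`n.choose k * E[U ^ (n - k); U < 1 - ε]`, which is the binomial tail. Finally let `ρ → 0`.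
-/

namespace ScenarioProgram

section BinomialTail

open Polynomial

/-- The lower binomial tail: `binomialTail N k` at `ε` is the probability of fewer than `k`
successes in `N` independent trials of success probability `ε`. Being a sum of Bernstein
polynomials, it is a polynomial in `ε`. -/
noncomputable def binomialTail (N k : ℕ) : ℝ[X] :=
  ∑ j ∈ Finset.range k, bernsteinPolynomial ℝ N j

theorem eval_binomialTail (N k : ℕ) (ε : ℝ) :
    (binomialTail N k).eval ε =
      ∑ j ∈ Finset.range k, (N.choose j : ℝ) * ε ^ j * (1 - ε) ^ (N - j) := by
  simp [binomialTail, bernsteinPolynomial, eval_finsetSum]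

theorem bernsteinPolynomial_succ_succ (R : Type*) [CommRing R] (n k : ℕ) :
    bernsteinPolynomial R (n + 1) (k + 1) =
      (1 - X) * bernsteinPolynomial R n (k + 1) + X * bernsteinPolynomial R n k := by
  rcases lt_or_ge k n with hk | hk
  · obtain ⟨m, rfl⟩ := Nat.exists_eq_add_of_lt hk
    simp only [bernsteinPolynomial, Nat.choose_succ_succ (k + m + 1) k, Nat.cast_add,
      show k + m + 1 + 1 - (k + 1) = m + 1 by omega, show k + m + 1 - (k + 1) = m by omega,
      show k + m + 1 - k = m + 1 by omega]
    ring
  · rw [bernsteinPolynomial.eq_zero_of_lt R (Nat.lt_succ_of_le hk)]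
    simp [bernsteinPolynomial, Nat.choose_succ_succ,
      Nat.choose_eq_zero_of_lt (Nat.lt_succ_of_le hk),
      Nat.sub_eq_zero_of_le hk]
    ring

theorem binomialTail_succ_succ (N k : ℕ) :
    binomialTail (N + 1) (k + 1) =
      (1 - X) * binomialTail N (k + 1) + X * binomialTail N k := by
  have h0 : bernsteinPolynomial ℝ (N + 1) 0 = (1 - X) * bernsteinPolynomial ℝ N 0 := by
    simp [bernsteinPolynomial, pow_succ']
  simp only [binomialTail, Finset.sum_range_succ' _ k, bernsteinPolynomial_succ_succ, h0,
    Finset.sum_add_distrib, ← Finset.mul_sum]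
  ring

theorem derivative_binomialTail_succ (N k : ℕ) :
    derivative (binomialTail N (k + 1)) = -(N * bernsteinPolynomial ℝ (N - 1) k) := by
  induction k with
  | zero => simp [binomialTail, bernsteinPolynomial.derivative_zero]
  | succ k ih =>
    rw [binomialTail, Finset.sum_range_succ, derivative_add, ← binomialTail, ih,
      bernsteinPolynomial.derivative_succ]
    ring

theorem binomialTail_eq_one_of_lt {N k : ℕ} (h : N < k) : binomialTail N k = 1 := by
  rw [← bernsteinPolynomial.sum ℝ N]
  refine (Finset.sum_subset (Finset.range_mono h) fun j _ hj => ?_).symm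
  exact bernsteinPolynomial.eq_zero_of_lt ℝ (by simpa using hj)

theorem eval_zero_binomialTail_succ (N k : ℕ) : (binomialTail N (k + 1)).eval 0 = 1 := by
  simp [binomialTail, eval_finsetSum, bernsteinPolynomial.eval_at_0]

theorem eval_one_binomialTail {N k : ℕ} (h : k ≤ N) : (binomialTail N k).eval 1 = 0 := by
  rw [binomialTail, eval_finsetSum]
  refine Finset.sum_eq_zero fun j hj => ?_
  rw [bernsteinPolynomial.eval_at_1, if_neg ((Finset.mem_range.1 hj).trans_le h).ne]

theorem monotone_eval_binomialTail (N : ℕ) {ε : ℝ} (hε : ε ∈ Set.Icc 0 1) :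
    Monotone fun k => (binomialTail N k).eval ε := by
  have h1 : 0 ≤ 1 - ε := sub_nonneg.2 hε.2
  have h0 := hε.1
  refine monotone_nat_of_le_succ fun k => ?_
  simp only [eval_binomialTail, Finset.sum_range_succ _ k]
  exact le_add_of_nonneg_right (by positivity)

theorem antitone_eval_binomialTail {ε : ℝ} (hε : ε ∈ Set.Icc 0 1) (k : ℕ) :
    Antitone fun N => (binomialTail N k).eval ε := by
  refine antitone_nat_of_succ_le fun N => ?_
  rcases k with _ | k
  · simp [binomialTail]
  · have hmono := mul_le_mul_of_nonneg_left (monotone_eval_binomialTail N hε k.le_succ) hε.1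
    simp only [binomialTail_succ_succ, eval_add, eval_mul, eval_sub, eval_one, eval_X]
    linarith

theorem tendsto_choose_mul_pow_mul_pow {ε : ℝ} (hε : ε ∈ Set.Ioo 0 1) (j : ℕ) :
    Filter.Tendsto (fun N : ℕ => (N.choose j : ℝ) * ε ^ j * (1 - ε) ^ (N - j))
      Filter.atTop (nhds 0) := by
  have h0 := hε.1
  have h1 : 0 < 1 - ε := sub_pos.2 hε.2
  have hlim := (tendsto_pow_const_mul_const_pow_of_abs_lt_one j
    (by rw [abs_of_pos h1]; linarith : |1 - ε| < 1)).const_mul (ε ^ j / (1 - ε) ^ j)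
  rw [mul_zero] at hlim
  refine squeeze_zero' (Filter.Eventually.of_forall fun N => by positivity) ?_ hlim
  filter_upwards [Filter.eventually_ge_atTop j] with N hN
  have hchoose : (N.choose j : ℝ) ≤ (N : ℝ) ^ j := by exact_mod_cast Nat.choose_le_pow N j
  calc (N.choose j : ℝ) * ε ^ j * (1 - ε) ^ (N - j)
      ≤ (N : ℝ) ^ j * ε ^ j * (1 - ε) ^ (N - j) := by gcongr
    _ = ε ^ j / (1 - ε) ^ j * ((N : ℝ) ^ j * (1 - ε) ^ N) := by
        rw [pow_sub₀ _ h1.ne' hN]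
        ring

theorem tendsto_eval_binomialTail {ε : ℝ} (hε : ε ∈ Set.Ioo 0 1) (k : ℕ) :
    Filter.Tendsto (fun N => (binomialTail N k).eval ε) Filter.atTop (nhds 0) := by
  simp only [eval_binomialTail]
  simpa using tendsto_finsetSum _ fun j _ => tendsto_choose_mul_pow_mul_pow hε j

theorem eval_binomialTail_le_of_sampleSize_le {ε β : ℝ} (hε : ε ∈ Set.Ioo 0 1) (hβ : 0 < β)
    {k N : ℕ} (h : sampleSize ε β k ≤ N) : (binomialTail N k).eval ε ≤ β := by
  have hne : ∃ n, (binomialTail n k).eval ε ≤ β :=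
    ((tendsto_eval_binomialTail hε k).eventually (ge_mem_nhds hβ)).exists
  refine (antitone_eval_binomialTail (Set.Ioo_subset_Icc_self hε) k h).trans ?_
  simp only [eval_binomialTail] at hne ⊢
  exact Nat.sInf_mem hne

theorem le_of_sampleSize_le {ε β : ℝ} (hε : ε ∈ Set.Ioo 0 1) (hβ : β ∈ Set.Ioo 0 1)
    {k N : ℕ} (h : sampleSize ε β k ≤ N) : k ≤ N := by
  by_contra! hlt
  have hle := eval_binomialTail_le_of_sampleSize_le hε hβ.1 h
  rw [binomialTail_eq_one_of_lt hlt, eval_one] at hle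
  exact hle.not_gt hβ.2

theorem integral_incomplete_beta {N k : ℕ} (h : k + 1 ≤ N) (s : ℝ) :
    ∫ u in (0 : ℝ)..s, (k + 1) * (1 - u) ^ k * u ^ (N - (k + 1)) =
      (binomialTail N (k + 1)).eval (1 - s) / N.choose (k + 1) := by
  have hchoose : ((N.choose (k + 1) : ℕ) : ℝ) ≠ 0 := by exact_mod_cast (Nat.choose_pos h).ne'
  have habsorb : (N : ℝ) * (N - 1).choose k = N.choose (k + 1) * (k + 1) := by
    obtain ⟨n, rfl⟩ : ∃ n, N = n + 1 := ⟨N - 1, by omega⟩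
    exact_mod_cast Nat.add_one_mul_choose_eq n k
  have hderiv (u : ℝ) : HasDerivAt
      (fun u => (binomialTail N (k + 1)).eval (1 - u) / N.choose (k + 1))
      ((k + 1) * (1 - u) ^ k * u ^ (N - (k + 1))) u := by
    have hcomp := (((binomialTail N (k + 1)).hasDerivAt (1 - u)).comp u
      ((hasDerivAt_id u).const_sub 1)).div_const (N.choose (k + 1) : ℝ)
    refine hcomp.congr_deriv ?_
    rw [derivative_binomialTail_succ, div_eq_iff hchoose]
    simp only [bernsteinPolynomial, eval_neg, eval_mul, eval_natCast, eval_pow, eval_X, eval_sub,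
      eval_one, Nat.sub_sub, Nat.add_comm 1 k]
    linear_combination (1 - u) ^ k * u ^ (N - (k + 1)) * habsorb
  rw [intervalIntegral.integral_eq_sub_of_hasDerivAt (fun u _ => hderiv u)
    (Continuous.intervalIntegrable (by fun_prop) _ _), sub_zero, eval_one_binomialTail h, zero_div,
    sub_zero]

end BinomialTail

section Moments

theorem integrable_of_continuous_of_ae_mem_Icc {μ : Measure ℝ} [IsFiniteMeasure μ] {a b : ℝ}
    (hμ : ∀ᵐ u ∂μ, u ∈ Set.Icc a b) {f : ℝ → ℝ} (hf : Continuous f) : Integrable f μ := by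
  rw [← Measure.restrict_eq_self_of_ae_mem hμ]
  exact hf.continuousOn.integrableOn_compact isCompact_Icc

theorem integral_eval_polynomial {μ : Measure ℝ} [IsFiniteMeasure μ] {a b : ℝ}
    (hμ : ∀ᵐ u ∂μ, u ∈ Set.Icc a b) (p : Polynomial ℝ) :
    ∫ u, p.eval u ∂μ = ∑ i ∈ Finset.range (p.natDegree + 1), p.coeff i * ∫ u, u ^ i ∂μ := by
  simp only [Polynomial.eval_eq_sum_range, ← integral_const_mul]
  exact integral_finsetSum _ fun i _ => integrable_of_continuous_of_ae_mem_Icc hμ (by fun_prop)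

theorem abs_integral_sub_le_of_abs_sub_le {μ : Measure ℝ} [IsFiniteMeasure μ] {a b : ℝ}
    (hμ : ∀ᵐ u ∂μ, u ∈ Set.Icc a b) {f g : ℝ → ℝ} (hf : Continuous f) (hg : Continuous g) {η : ℝ}
    (h : ∀ u ∈ Set.Icc a b, |f u - g u| ≤ η) :
    |∫ u, f u ∂μ - ∫ u, g u ∂μ| ≤ η * μ.real Set.univ := by
  rw [← integral_sub (integrable_of_continuous_of_ae_mem_Icc hμ hf)
    (integrable_of_continuous_of_ae_mem_Icc hμ hg), ← Real.norm_eq_abs]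
  exact norm_integral_le_of_norm_le_const (hμ.mono h)

theorem measure_eq_of_moments_eq {μ ν : Measure ℝ} [IsFiniteMeasure μ] [IsFiniteMeasure ν]
    {a b : ℝ} (hμ : ∀ᵐ u ∂μ, u ∈ Set.Icc a b) (hν : ∀ᵐ u ∂ν, u ∈ Set.Icc a b)
    (h : ∀ m : ℕ, ∫ u, u ^ m ∂μ = ∫ u, u ^ m ∂ν) : μ = ν := by
  refine ext_of_forall_integral_eq_of_IsFiniteMeasure fun f => eq_of_forall_dist_le fun η hη => ?_
  set C := μ.real Set.univ + ν.real Set.univ + 1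
  have hC : 0 < C := by positivity
  obtain ⟨p, hp⟩ := exists_polynomial_near_of_continuousOn a b f f.continuous.continuousOn
    (η / C) (by positivity)
  have hfp : ∀ u ∈ Set.Icc a b, |f u - p.eval u| ≤ η / C := fun u hu => by
    rw [abs_sub_comm]
    exact (hp u hu).le
  have hpolynomial : ∫ u, p.eval u ∂μ = ∫ u, p.eval u ∂ν := by
    simp only [integral_eval_polynomial hμ, integral_eval_polynomial hν, h]
  calc dist (∫ u, f u ∂μ) (∫ u, f u ∂ν)
      ≤ dist (∫ u, f u ∂μ) (∫ u, p.eval u ∂μ) + dist (∫ u, f u ∂ν) (∫ u, p.eval u ∂ν) := by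
        rw [hpolynomial]
        exact dist_triangle_right _ _ _
    _ ≤ η / C * μ.real Set.univ + η / C * ν.real Set.univ :=
        add_le_add (abs_integral_sub_le_of_abs_sub_le hμ f.continuous p.continuous hfp)
          (abs_integral_sub_le_of_abs_sub_le hν f.continuous p.continuous hfp)
    _ ≤ η / C * C := by
        rw [← mul_add]
        exact mul_le_mul_of_nonneg_left (le_add_of_nonneg_right zero_le_one) (by positivity)
    _ = η := div_mul_cancel₀ η hC.ne'

end Moments

section Beta

open ProbabilityTheory

theorem betaPDFReal_one_natCast_succ (k : ℕ) {u : ℝ} (hu : u ∈ Set.Ioo (0 : ℝ) 1) :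
    betaPDFReal 1 (k + 1) u = (k + 1) * (1 - u) ^ k := by
  have hGamma : Real.Gamma (1 + (k + 1)) = (k + 1) * Real.Gamma (k + 1) := by
    rw [add_comm]
    exact Real.Gamma_add_one (by positivity)
  have : 0 < Real.Gamma (k + 1) := Real.Gamma_pos_of_pos (by positivity)
  rw [betaPDFReal, if_pos (Set.mem_Ioo.1 hu), beta, hGamma, Real.Gamma_one]
  simp only [sub_self, Real.rpow_zero, add_sub_cancel_right, Real.rpow_natCast]
  field_simp

theorem measurable_betaPDF (α β : ℝ) : Measurable (betaPDF α β) :=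
  (measurable_betaPDFReal α β).ennreal_ofReal

theorem ae_mem_Ioo_betaMeasure (α β : ℝ) : ∀ᵐ u ∂betaMeasure α β, u ∈ Set.Ioo (0 : ℝ) 1 := by
  refine (ae_withDensity_iff (measurable_betaPDF _ _)).2 (ae_of_all _ fun u hu => ?_)
  by_contra hmem
  exact hu ((betaPDF_eq α β u).trans (by rw [if_neg (by simpa using hmem), ENNReal.ofReal_zero]))

theorem setIntegral_Iic_pow_betaMeasure (k m : ℕ) {s : ℝ} (hs : s ∈ Set.Icc 0 1) :
    ∫ u in Set.Iic s, u ^ m ∂betaMeasure 1 (k + 1) =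
      ∫ u in (0 : ℝ)..s, (k + 1) * (1 - u) ^ k * u ^ m := by
  have hoff : ∀ u ∈ Set.Iic s \ Set.Ioc 0 s, (betaPDF 1 (k + 1) u).toReal • u ^ m = 0 := by
    rintro u ⟨hus, hu⟩
    rw [betaPDF_eq_zero_of_nonpos (not_lt.1 fun h0 => hu ⟨h0, hus⟩), ENNReal.toReal_zero, zero_smul]
  rw [betaMeasure, setIntegral_withDensity_eq_setIntegral_toReal_smul (measurable_betaPDF _ _)
    (ae_of_all _ fun u => ENNReal.ofReal_lt_top) _ measurableSet_Iic,
    setIntegral_eq_of_subset_of_forall_sdiff_eq_zero measurableSet_Iic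
      (fun u hu => hu.2) hoff,
    intervalIntegral.integral_of_le hs.1, integral_Ioc_eq_integral_Ioo,
    integral_Ioc_eq_integral_Ioo]
  refine setIntegral_congr_fun measurableSet_Ioo fun u hu => ?_
  have hu1 : u < 1 := hu.2.trans_le hs.2
  have : 0 ≤ (1 - u) ^ k := pow_nonneg (sub_nonneg.2 hu1.le) k
  simp only [smul_eq_mul, betaPDF, betaPDFReal_one_natCast_succ k ⟨hu.1, hu1⟩]
  rw [ENNReal.toReal_ofReal (by positivity)]

theorem setIntegral_Iic_pow_betaMeasure_eq_binomialTail {N k : ℕ} (h : k + 1 ≤ N) {s : ℝ}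
    (hs : s ∈ Set.Icc 0 1) :
    ∫ u in Set.Iic s, u ^ (N - (k + 1)) ∂betaMeasure 1 (k + 1) =
      (binomialTail N (k + 1)).eval (1 - s) / N.choose (k + 1) := by
  rw [setIntegral_Iic_pow_betaMeasure k _ hs, integral_incomplete_beta h]

theorem integral_pow_betaMeasure {n k : ℕ} (h : k + 1 ≤ n) :
    ∫ u, u ^ (n - (k + 1)) ∂betaMeasure 1 (k + 1) = 1 / n.choose (k + 1) := by
  have hIic : ∀ᵐ u ∂betaMeasure 1 (k + 1), u ∈ Set.Iic 1 :=
    (ae_mem_Ioo_betaMeasure 1 (k + 1)).mono fun u hu => hu.2.le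
  rw [← Measure.restrict_eq_self_of_ae_mem hIic,
    setIntegral_Iic_pow_betaMeasure_eq_binomialTail h ⟨zero_le_one, le_rfl⟩, sub_self,
    eval_zero_binomialTail_succ]

theorem eq_betaMeasure_of_choose_mul_integral_pow_eq_one {ν : Measure ℝ} [IsFiniteMeasure ν]
    {k : ℕ} (hν : ∀ᵐ u ∂ν, u ∈ Set.Icc (0 : ℝ) 1)
    (hmoments : ∀ n, k + 1 ≤ n → n.choose (k + 1) * ∫ u, u ^ (n - (k + 1)) ∂ν = 1) :
    ν = betaMeasure 1 (k + 1) := by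
  have : IsProbabilityMeasure (betaMeasure 1 (k + 1)) :=
    isProbabilityMeasureBeta one_pos (by positivity)
  refine measure_eq_of_moments_eq hν
    ((ae_mem_Ioo_betaMeasure 1 (k + 1)).mono fun u hu => Set.Ioo_subset_Icc_self hu) fun m => ?_
  have hle : k + 1 ≤ m + (k + 1) := Nat.le_add_left _ _
  rw [← Nat.add_sub_cancel (n := m) (m := k + 1), integral_pow_betaMeasure hle]
  exact eq_one_div_of_mul_eq_one_right (hmoments _ hle)

end Beta

section Compression

variable {Ω : Type*} [MeasurableSpace Ω] (Q : Measure Ω) [IsProbabilityMeasure Q]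

/-- A test `G` on subsamples of size `k`: `G A e` says that the point `e` passes the test set up by
the set `A` of sample points, jointly measurably in the `k` points of `A` and in `e`. -/
def IsMeasurableTest (k : ℕ) (G : Set Ω → Ω → Prop) : Prop :=
  MeasurableSet {p : (Fin k → Ω) × Ω | G (Set.range p.1) p.2}

/-- A compression scheme of size `k` for samples from `Q`: almost surely, a sample of at least `k`
points has exactly one subsample of size `k` whose test is passed by all the other points. -/
structure IsCompressionScheme (k : ℕ) (G : Set Ω → Ω → Prop) : Prop where
  isMeasurableTest : IsMeasurableTest k G
  ae_existsUnique : ∀ (ι : Type) [Fintype ι], k ≤ Fintype.card ι →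
    ∀ᵐ ω ∂Measure.pi fun _ : ι => Q, ∃! I : Finset ι, I.card = k ∧ ∀ j ∉ I, G (ω '' I) (ω j)

/-- The law of the probability that a new point passes the test set up by `k` independent
points. -/
noncomputable def passingLaw (k : ℕ) (G : Set Ω → Ω → Prop) : Measure ℝ :=
  (Measure.pi fun _ : Fin k => Q).map fun w => Q.real {e | G (Set.range w) e}

variable {k : ℕ} {G : Set Ω → Ω → Prop}

theorem IsMeasurableTest.measurable_measureReal (hG : IsMeasurableTest k G) :
    Measurable fun w : Fin k → Ω => Q.real {e | G (Set.range w) e} :=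
  (measurable_measure_prodMk_left hG).ennreal_toReal

theorem IsMeasurableTest.isProbabilityMeasure_passingLaw (hG : IsMeasurableTest k G) :
    IsProbabilityMeasure (passingLaw Q k G) :=
  Measure.isProbabilityMeasure_map (hG.measurable_measureReal Q).aemeasurable

theorem IsMeasurableTest.ae_mem_Icc_passingLaw (hG : IsMeasurableTest k G) :
    ∀ᵐ u ∂passingLaw Q k G, u ∈ Set.Icc (0 : ℝ) 1 :=
  (ae_map_iff (hG.measurable_measureReal Q).aemeasurable measurableSet_Icc).2
    (ae_of_all _ fun _ => ⟨measureReal_nonneg, measureReal_le_one⟩)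

theorem measureReal_prod_eq_integral {α β : Type*} [MeasurableSpace α] [MeasurableSpace β]
    (μ : Measure α) (ν : Measure β) [IsFiniteMeasure ν] {s : Set (α × β)}
    (hs : MeasurableSet s) : (μ.prod ν).real s = ∫ a, ν.real (Prod.mk a ⁻¹' s) ∂μ := by
  rw [measureReal_def, Measure.prod_apply hs]
  exact (integral_toReal (measurable_measure_prodMk_left hs).aemeasurable
    (ae_of_all _ fun a => measure_lt_top ν _)).symm

theorem IsMeasurableTest.measurableSet_mem_and_forall_pass (hG : IsMeasurableTest k G)
    (κ : Type*) [Countable κ] {B : Set ℝ} (hB : MeasurableSet B) :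
    MeasurableSet {p : (Fin k → Ω) × (κ → Ω) |
      Q.real {e | G (Set.range p.1) e} ∈ B ∧ ∀ j, G (Set.range p.1) (p.2 j)} := by
  simp only [Set.ofPred_and, Set.ofPred_forall]
  refine (measurable_fst (hG.measurable_measureReal Q hB)).inter (.iInter fun j => ?_)
  have hproj : Measurable fun p : (Fin k → Ω) × (κ → Ω) => (p.1, p.2 j) := by fun_prop
  exact hproj hG

theorem IsMeasurableTest.measureReal_prod_forall_pass (hG : IsMeasurableTest k G)
    (κ : Type*) [Fintype κ] {B : Set ℝ} (hB : MeasurableSet B) :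
    ((Measure.pi fun _ : Fin k => Q).prod (Measure.pi fun _ : κ => Q)).real
        {p | Q.real {e | G (Set.range p.1) e} ∈ B ∧ ∀ j, G (Set.range p.1) (p.2 j)} =
      ∫ u in B, u ^ Fintype.card κ ∂passingLaw Q k G := by
  have hU := hG.measurable_measureReal Q
  have hslice (w : Fin k → Ω) : (Measure.pi fun _ : κ => Q).real (Prod.mk w ⁻¹'
        {p | Q.real {e | G (Set.range p.1) e} ∈ B ∧ ∀ j, G (Set.range p.1) (p.2 j)}) =
      ((fun w => Q.real {e | G (Set.range w) e}) ⁻¹' B).indicator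
        (fun w => Q.real {e | G (Set.range w) e} ^ Fintype.card κ) w := by
    by_cases hw : Q.real {e | G (Set.range w) e} ∈ B
    · have hpi : Prod.mk w ⁻¹' {p : (Fin k → Ω) × (κ → Ω) |
            Q.real {e | G (Set.range p.1) e} ∈ B ∧ ∀ j, G (Set.range p.1) (p.2 j)} =
          Set.univ.pi fun _ => {e | G (Set.range w) e} := by
        ext z
        simp [hw]
      rw [Set.indicator_of_mem (by exact hw), hpi, measureReal_def, Measure.pi_pi,
        Finset.prod_const, Finset.card_univ, ENNReal.toReal_pow, measureReal_def]
    · simp [hw]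
  rw [measureReal_prod_eq_integral _ _ (hG.measurableSet_mem_and_forall_pass Q κ hB)]
  simp only [hslice]
  rw [integral_indicator (hU hB), passingLaw, setIntegral_map hB (by fun_prop) hU.aemeasurable]

theorem measurePreserving_subsample_prod {ι : Type*} [Fintype ι] [DecidableEq ι]
    {I : Finset ι} (e : I ≃ Fin k) :
    MeasurePreserving (fun ω : ι → Ω => (fun i => ω (e.symm i), fun j : {j // j ∉ I} => ω j))
      (Measure.pi fun _ => Q) ((Measure.pi fun _ : Fin k => Q).prod (Measure.pi fun _ => Q)) := by
  have hreindex := measurePreserving_arrowCongr' (fun _ => Q) (fun _ => Q) e (.refl Ω)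
    fun _ => .id Q
  have hsplit : MeasurePreserving (MeasurableEquiv.piEquivPiSubtypeProd (fun _ => Ω) (· ∈ I))
      (Measure.pi fun _ => Q)
      ((Measure.pi fun _ : I => Q).prod (Measure.pi fun _ : {j // j ∉ I} => Q)) := by
    convert! measurePreserving_piEquivPiSubtypeProd (fun _ : ι => Q) (· ∈ I)
  convert! (hreindex.prod (.id (Measure.pi fun _ : {j // j ∉ I} => Q))).comp hsplit

theorem image_eq_range_symm {α ι : Type*} {I : Finset ι} (e : I ≃ Fin k) (ω : ι → α) :
    ω '' I = Set.range fun i => ω (e.symm i) := by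
  rw [Set.image_eq_range]
  exact (e.symm.surjective.range_comp fun j : I => ω j).symm

theorem IsMeasurableTest.measureReal_pi_forall_notMem_pass (hG : IsMeasurableTest k G)
    {ι : Type*} [Fintype ι] {I : Finset ι} (hI : I.card = k) {B : Set ℝ} (hB : MeasurableSet B) :
    (Measure.pi fun _ : ι => Q).real
        {ω | Q.real {e | G (ω '' I) e} ∈ B ∧ ∀ j ∉ I, G (ω '' I) (ω j)} =
      ∫ u in B, u ^ (Fintype.card ι - k) ∂passingLaw Q k G := by
  classical
  have hsplit := measurePreserving_subsample_prod Q (I.equivFinOfCardEq hI)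
  have hcard : Fintype.card {j // j ∉ I} = Fintype.card ι - k := by simp [hI]
  rw [← hcard, ← hG.measureReal_prod_forall_pass Q {j // j ∉ I} hB, ← hsplit.measureReal_preimage
    (hG.measurableSet_mem_and_forall_pass Q _ hB).nullMeasurableSet]
  congr 1
  ext ω
  simp [← image_eq_range_symm]

theorem IsMeasurableTest.measurableSet_forall_notMem_pass (hG : IsMeasurableTest k G)
    {ι : Type*} [Finite ι] {I : Finset ι} (hI : I.card = k) :
    MeasurableSet {ω : ι → Ω | ∀ j ∉ I, G (ω '' I) (ω j)} := by
  simp only [image_eq_range_symm (I.equivFinOfCardEq hI), Set.ofPred_forall]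
  refine .iInter fun j => .iInter fun _ => ?_
  exact (Measurable.prodMk (by fun_prop) (measurable_pi_apply j) :
    Measurable fun ω : ι → Ω => (fun i => ω ((I.equivFinOfCardEq hI).symm i), ω j)) hG

variable {Q}

theorem IsCompressionScheme.choose_mul_integral_pow_passingLaw (hG : IsCompressionScheme Q k G)
    {n : ℕ} (hn : k ≤ n) : n.choose k * ∫ u, u ^ (n - k) ∂passingLaw Q k G = 1 := by
  let passed (I : Finset (Fin n)) : Set (Fin n → Ω) := {ω | ∀ j ∉ I, G (ω '' I) (ω j)}
  have hunique := hG.ae_existsUnique (Fin n) (by simpa using hn)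
  have hprob : ∀ I ∈ Finset.powersetCard k Finset.univ,
      (Measure.pi fun _ => Q).real (passed I) = ∫ u, u ^ (n - k) ∂passingLaw Q k G := fun I hI => by
    simpa [passed] using hG.isMeasurableTest.measureReal_pi_forall_notMem_pass Q
      (Finset.mem_powersetCard.1 hI).2 MeasurableSet.univ
  have hdisjoint : Set.Pairwise (Finset.powersetCard k (Finset.univ : Finset (Fin n)))
      (Function.onFun (AEDisjoint (Measure.pi fun _ => Q)) passed) := fun I hI K hK hne => by
    refine measure_eq_zero_iff_ae_notMem.2 (hunique.mono fun ω hω hmem => hne ?_)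
    exact hω.unique ⟨(Finset.mem_powersetCard.1 hI).2, hmem.1⟩
      ⟨(Finset.mem_powersetCard.1 hK).2, hmem.2⟩
  have hcover : (Measure.pi fun _ => Q).real
      (⋃ I ∈ Finset.powersetCard k Finset.univ, passed I) = 1 := by
    rw [measureReal_congr (t := Set.univ), probReal_univ]
    refine Filter.eventuallyEq_univ.2 (hunique.mono fun ω hω => ?_)
    obtain ⟨I, ⟨hI, hpass⟩, -⟩ := hω
    exact Set.mem_biUnion (Finset.mem_powersetCard.2 ⟨Finset.subset_univ I, hI⟩) hpass
  rw [measureReal_biUnion_finset₀ hdisjoint fun I hI =>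
    (hG.isMeasurableTest.measurableSet_forall_notMem_pass
      (Finset.mem_powersetCard.1 hI).2).nullMeasurableSet, Finset.sum_congr rfl hprob] at hcover
  simpa using hcover

theorem IsCompressionScheme.passingLaw_eq_betaMeasure (hG : IsCompressionScheme Q (k + 1) G) :
    passingLaw Q (k + 1) G = ProbabilityTheory.betaMeasure 1 (k + 1) :=
  have := hG.isMeasurableTest.isProbabilityMeasure_passingLaw Q
  eq_betaMeasure_of_choose_mul_integral_pow_eq_one (hG.isMeasurableTest.ae_mem_Icc_passingLaw Q)
    fun _ hn => hG.choose_mul_integral_pow_passingLaw hn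

theorem IsCompressionScheme.measureReal_exists_pass_le (hG : IsCompressionScheme Q (k + 1) G)
    {ι : Type*} [Fintype ι] (hk : k + 1 ≤ Fintype.card ι) {s : ℝ} (hs : s ∈ Set.Icc 0 1) :
    (Measure.pi fun _ : ι => Q).real {ω | ∃ I : Finset ι, I.card = k + 1 ∧
        Q.real {e | G (ω '' I) e} ≤ s ∧ ∀ j ∉ I, G (ω '' I) (ω j)} ≤
      (binomialTail (Fintype.card ι) (k + 1)).eval (1 - s) := by
  have hprob : ∀ I ∈ Finset.powersetCard (k + 1) (Finset.univ : Finset ι),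
      (Measure.pi fun _ : ι => Q).real
        {ω | Q.real {e | G (ω '' I) e} ≤ s ∧ ∀ j ∉ I, G (ω '' I) (ω j)} =
      (binomialTail (Fintype.card ι) (k + 1)).eval (1 - s) /
        (Fintype.card ι).choose (k + 1) := fun I hI => by
    rw [← setIntegral_Iic_pow_betaMeasure_eq_binomialTail hk hs, ← hG.passingLaw_eq_betaMeasure]
    exact hG.isMeasurableTest.measureReal_pi_forall_notMem_pass Q
      (Finset.mem_powersetCard.1 hI).2 measurableSet_Iic
  calc _ = (Measure.pi fun _ : ι => Q).real (⋃ I ∈ Finset.powersetCard (k + 1) Finset.univ,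
        {ω | Q.real {e | G (ω '' I) e} ≤ s ∧ ∀ j ∉ I, G (ω '' I) (ω j)}) := by
        congr 1
        ext ω
        simp [and_left_comm]
    _ ≤ ∑ I ∈ Finset.powersetCard (k + 1) Finset.univ, (Measure.pi fun _ : ι => Q).real
        {ω | Q.real {e | G (ω '' I) e} ≤ s ∧ ∀ j ∉ I, G (ω '' I) (ω j)} :=
        measureReal_biUnion_finset_le _ _
    _ = (binomialTail (Fintype.card ι) (k + 1)).eval (1 - s) := by
        rw [Finset.sum_congr rfl hprob, Finset.sum_const, Finset.card_powersetCard,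
          Finset.card_univ, nsmul_eq_mul]
        exact mul_div_cancel₀ _ (by exact_mod_cast (Nat.choose_pos hk).ne')

end Compression

section LowestSuperset

variable {ι α : Type*} [LinearOrder α] {t : ι → α} {B : Finset ι} {k : ℕ}

theorem exists_lowest_superset [Fintype ι] (ht : Function.Injective t) (hB : B.card ≤ k)
    (hk : k ≤ Fintype.card ι) :
    ∃ I : Finset ι, I.card = k ∧ B ⊆ I ∧ ∀ i ∈ I, i ∉ B → ∀ j ∉ I, t i < t j := by
  classical
  induction k, hB using Nat.le_induction with
  | base => exact ⟨B, rfl, subset_rfl, fun i hi hi' => absurd hi hi'⟩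
  | succ k _ ih =>
    obtain ⟨I, hI, hBI, hlow⟩ := ih (by lia)
    have hcompl : Iᶜ.Nonempty := Finset.card_pos.1 (by rw [Finset.card_compl]; lia)
    obtain ⟨a, ha, hmin⟩ := Iᶜ.exists_min_image t hcompl
    rw [Finset.mem_compl] at ha
    refine ⟨insert a I, by rw [Finset.card_insert_of_notMem ha, hI],
      hBI.trans (Finset.subset_insert a I), fun i hi hiB j hj => ?_⟩
    rw [Finset.mem_insert, not_or] at hj
    rcases Finset.mem_insert.1 hi with rfl | hi
    · exact (hmin j (Finset.mem_compl.2 hj.2)).lt_of_ne (ht.ne (Ne.symm hj.1))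
    · exact hlow i hi hiB j hj.2

theorem lowest_superset_unique {I K : Finset ι} (hcard : I.card = K.card) (hBI : B ⊆ I)
    (hI : ∀ i ∈ I, i ∉ B → ∀ j ∉ I, t i < t j) (hBK : B ⊆ K)
    (hK : ∀ i ∈ K, i ∉ B → ∀ j ∉ K, t i < t j) : I = K := by
  by_contra hne
  obtain ⟨a, haI, haK⟩ := Finset.not_subset.1 fun h =>
    hne (Finset.eq_of_subset_of_card_le h hcard.ge)
  obtain ⟨b, hbK, hbI⟩ := Finset.not_subset.1 fun h =>
    hne (Finset.eq_of_subset_of_card_le h hcard.le).symm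
  exact lt_asymm (hI a haI (fun h => haK (hBK h)) b hbI) (hK b hbK (fun h => hbI (hBI h)) a haK)

end LowestSuperset

section LPType

variable {Ω : Type*}

/-- An LP-type problem of combinatorial dimension at most `k`, given by its value function on
sets of constraints; only the values on finite sets are relevant. -/
structure IsLPType (k : ℕ) (v : Set Ω → ℝ) : Prop where
  mono : ∀ A B : Set Ω, B.Finite → A ⊆ B → v A ≤ v B
  basis : ∀ A : Set Ω, A.Finite → ∃ B ⊆ A, B.ncard ≤ k ∧ v B = v A
  locality : ∀ A S : Set Ω, A.Finite → S.Finite → (∀ e ∈ S, v (insert e A) = v A) →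
    v (A ∪ S) = v A

/-- The constraint `e` does not alter the value on `A`, nor does it come before a constraint of
`A` that is not needed for this value, in the order given by the labels `τ`. Deleting `a` from `A`
is expressed through the labels, as `{b ∈ A | τ b ≠ τ a}`, since points of `Ω` need not be
measurable. -/
def IsCompatible (v : Set Ω → ℝ) (τ : Ω → ℝ) (A : Set Ω) (e : Ω) : Prop :=
  v (insert e A) = v A ∧ ∀ a ∈ A, v {b ∈ A | τ b ≠ τ a} = v A → τ a < τ e

/-- A sample with distinct labels in which no value is attained on two different bases: if `j` is
in the first of two subsamples with the same value but not in the second, then it can be dropped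
from the first. -/
def IsNondegenerate (v : Set Ω → ℝ) (τ : Ω → ℝ) {ι : Type*} (ω : ι → Ω) : Prop :=
  Function.Injective (τ ∘ ω) ∧ ∀ I K : Set ι, ∀ j ∈ I, j ∉ K →
    v (ω '' I) = v (ω '' K) → v (ω '' (I \ {j})) = v (ω '' I)

variable {k : ℕ} {v : Set Ω → ℝ} {τ : Ω → ℝ} {ι : Type*} {ω : ι → Ω} {I : Finset ι}

theorem insert_apply_image (ω : ι → Ω) (I : Set ι) (j : ι) :
    insert (ω j) (ω '' I) = ω '' insert j I :=
  Set.image_insert_eq.symm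

theorem apply_insert_image_eq_of_mem_range
    (hI : ∀ j ∉ I, v (insert (ω j) (ω '' I)) = v (ω '' I))
    {e : Ω} (he : e ∈ Set.range ω) : v (insert e (ω '' I)) = v (ω '' I) := by
  obtain ⟨j, rfl⟩ := he
  by_cases hj : j ∈ I
  · rw [Set.insert_eq_of_mem (Set.mem_image_of_mem ω hj)]
  · exact hI j hj

theorem image_sdiff_singleton_eq_sep (hω : Function.Injective (τ ∘ ω)) (I : Set ι) (i : ι) :
    {b ∈ ω '' I | τ b ≠ τ (ω i)} = ω '' (I \ {i}) := by
  ext b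
  constructor
  · rintro ⟨⟨l, hl, rfl⟩, hne⟩
    exact ⟨l, ⟨hl, fun h => hne (h ▸ rfl)⟩, rfl⟩
  · rintro ⟨l, ⟨hl, hne⟩, rfl⟩
    exact ⟨⟨l, hl, rfl⟩, fun h => hne (hω h)⟩

theorem IsLPType.apply_range_eq [Finite ι] (hv : IsLPType k v)
    (hI : ∀ j ∉ I, v (insert (ω j) (ω '' I)) = v (ω '' I)) : v (Set.range ω) = v (ω '' I) := by
  rw [← hv.locality _ _ (Set.toFinite _) (Set.finite_range ω) fun _ =>
    apply_insert_image_eq_of_mem_range hI, Set.union_eq_right.2 (Set.image_subset_range ω I)]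

theorem IsLPType.apply_insert_range_eq [Finite ι] (hv : IsLPType k v)
    (hI : ∀ j ∉ I, v (insert (ω j) (ω '' I)) = v (ω '' I)) {e : Ω}
    (he : v (insert e (ω '' I)) = v (ω '' I)) :
    v (insert e (Set.range ω)) = v (Set.range ω) := by
  rw [hv.apply_range_eq hI, ← hv.locality (ω '' I) (insert e (Set.range ω)) (Set.toFinite _)
    ((Set.finite_range ω).insert e) (Set.forall_mem_insert.2 ⟨he, fun _ =>
      apply_insert_image_eq_of_mem_range hI⟩), Set.union_insert,
    Set.union_eq_right.2 (Set.image_subset_range ω I)]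

theorem IsLPType.exists_finset_basis [Finite ι] (hv : IsLPType k v) (hω : Function.Injective ω) :
    ∃ B : Finset ι, B.card ≤ k ∧ v (ω '' B) = v (Set.range ω) := by
  obtain ⟨A, hA, hAk, hvA⟩ := hv.basis (Set.range ω) (Set.finite_range ω)
  obtain ⟨B, rfl⟩ := Set.subset_range_iff_exists_image_eq.1 hA
  refine ⟨B.toFinite.toFinset, ?_, by rwa [Set.Finite.coe_toFinset]⟩
  rwa [Set.ncard_image_of_injective _ hω, Set.ncard_eq_toFinset_card] at hAk

theorem IsLPType.exists_core [Finite ι] (hv : IsLPType k v) (hω : IsNondegenerate v τ ω) :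
    ∃ B : Finset ι, B.card ≤ k ∧ ∀ I : Set ι, v (ω '' I) = v (Set.range ω) ↔ ↑B ⊆ I := by
  classical
  have := Fintype.ofFinite ι
  obtain ⟨B₀, hB₀k, hB₀⟩ := hv.exists_finset_basis hω.1.of_comp
  obtain ⟨B, hB, hmin⟩ := Finset.exists_min_image
    {B : Finset ι | v (ω '' B) = v (Set.range ω)} Finset.card ⟨B₀, by simpa using hB₀⟩
  simp only [Finset.mem_filter_univ] at hB hmin
  refine ⟨B, (hmin B₀ hB₀).trans hB₀k, fun I => ⟨fun hI j hj => ?_, fun hBI => ?_⟩⟩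
  · by_contra hjI
    have hdrop : v (ω '' (B.erase j : Finset ι)) = v (ω '' B) := by
      rw [Finset.coe_erase]
      exact hω.2 B I j hj hjI (hB.trans hI.symm)
    exact (Finset.card_erase_lt_of_mem hj).not_ge (hmin _ (hdrop.trans hB))
  · exact le_antisymm (hv.mono _ _ (Set.finite_range ω) (Set.image_subset_range ω I))
      (hB ▸ hv.mono _ _ (Set.toFinite _) (Set.image_mono hBI))

theorem IsLPType.forall_isCompatible_iff [Finite ι] (hv : IsLPType k v)
    (hω : Function.Injective (τ ∘ ω)) {B : Finset ι}
    (hB : ∀ I : Set ι, v (ω '' I) = v (Set.range ω) ↔ ↑B ⊆ I) :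
    (∀ j ∉ I, IsCompatible v τ (ω '' I) (ω j)) ↔
      B ⊆ I ∧ ∀ i ∈ I, i ∉ B → ∀ j ∉ I, τ (ω i) < τ (ω j) := by
  constructor
  · intro hI
    have hvI : v (ω '' I) = v (Set.range ω) := (hv.apply_range_eq fun j hj => (hI j hj).1).symm
    have hBI := (hB I).1 hvI
    refine ⟨by exact_mod_cast hBI, fun i hi hiB j hj =>
      (hI j hj).2 _ (Set.mem_image_of_mem ω hi) ?_⟩
    rw [image_sdiff_singleton_eq_sep hω, hvI]
    exact (hB _).2 (Set.subset_sdiff_singleton hBI hiB)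
  · rintro ⟨hBI, hlow⟩ j hj
    have hvI : v (ω '' I) = v (Set.range ω) := (hB I).2 (by exact_mod_cast hBI)
    refine ⟨?_, ?_⟩
    · rw [insert_apply_image, hvI]
      exact (hB _).2 ((Finset.coe_subset.2 hBI).trans (Set.subset_insert j _))
    · rintro _ ⟨i, hi, rfl⟩ hvi
      rw [image_sdiff_singleton_eq_sep hω, hvI] at hvi
      exact hlow i hi (fun hiB => ((hB _).1 hvi hiB).2 rfl) j hj

theorem IsLPType.existsUnique_isCompatible [Fintype ι] (hv : IsLPType k v)
    (hω : IsNondegenerate v τ ω) (hk : k ≤ Fintype.card ι) :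
    ∃! I : Finset ι, I.card = k ∧ ∀ j ∉ I, IsCompatible v τ (ω '' I) (ω j) := by
  obtain ⟨B, hBk, hB⟩ := hv.exists_core hω
  simp only [hv.forall_isCompatible_iff hω.1 hB]
  obtain ⟨I, hI, hBI, hlow⟩ := exists_lowest_superset hω.1 hBk hk
  exact ⟨I, ⟨hI, hBI, hlow⟩, fun K ⟨hK, hBK, hlowK⟩ =>
    lowest_superset_unique (hK.trans hI.symm) hBK hlowK hBI hlow⟩

end LPType

section LPTypeSampling

variable {Ω : Type*} [MeasurableSpace Ω] {k : ℕ} {v : Set Ω → ℝ} {τ : Ω → ℝ}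

theorem measurable_apply_image (hmeas : ∀ (ι : Type) [Finite ι],
    Measurable fun ω : ι → Ω => v (Set.range ω)) {ι : Type} [Finite ι] {T : (ι → Ω) → Set ι}
    (hT : ∀ i, MeasurableSet {ω | i ∈ T ω}) : Measurable fun ω : ι → Ω => v (ω '' T ω) := by
  classical
  have hfixed (J : Set ι) : Measurable fun ω : ι → Ω => v (ω '' J) := by
    simp only [Set.image_eq_range]
    exact (hmeas J).comp (by fun_prop)
  have hjoint : Measurable fun p : (ι → Ω) × Set ι => v (p.1 '' p.2) :=
    measurable_from_prod_countable_left hfixed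
  exact hjoint.comp (measurable_id.prodMk
    (measurable_set_iff.2 fun i => measurableSet_setOfPred.1 (hT i)))

theorem isMeasurableTest_isCompatible (hτ : Measurable τ) (hmeas : ∀ (ι : Type) [Finite ι],
    Measurable fun ω : ι → Ω => v (Set.range ω)) (k : ℕ) :
    IsMeasurableTest k (IsCompatible v τ) := by
  have hset : {p : (Fin k → Ω) × Ω | IsCompatible v τ (Set.range p.1) p.2} =
      {p | v (Set.range (Fin.cons p.2 p.1 : Fin (k + 1) → Ω)) = v (Set.range p.1)} ∩
        ⋂ i, {p | v (p.1 '' {l | τ (p.1 l) ≠ τ (p.1 i)}) = v (Set.range p.1) →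
          τ (p.1 i) < τ p.2} := by
    ext p
    have hsep (i : Fin k) : {b ∈ Set.range p.1 | τ b ≠ τ (p.1 i)} =
        p.1 '' {l | τ (p.1 l) ≠ τ (p.1 i)} := by
      ext b
      simp only [Set.mem_ofPred_eq, Set.mem_range, Set.mem_image]
      grind
    simp only [Set.mem_ofPred_eq, IsCompatible, Set.forall_mem_range, hsep, Fin.range_cons,
      Set.mem_inter_iff, Set.mem_iInter]
  have hcons : Measurable fun p : (Fin k → Ω) × Ω => (Fin.cons p.2 p.1 : Fin (k + 1) → Ω) :=
    measurable_pi_iff.2 (Fin.cases measurable_snd fun i =>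
      (measurable_pi_apply i).comp measurable_fst)
  have hrange : Measurable fun p : (Fin k → Ω) × Ω => v (Set.range p.1) :=
    (hmeas (Fin k)).comp measurable_fst
  have hlt (i : Fin k) : MeasurableSet {p : (Fin k → Ω) × Ω | τ (p.1 i) < τ p.2} :=
    measurableSet_lt (by fun_prop) (by fun_prop)
  have hdrop (i : Fin k) :
      Measurable fun ω : Fin k → Ω => v (ω '' {l | τ (ω l) ≠ τ (ω i)}) :=
    measurable_apply_image hmeas fun l =>
      (measurableSet_eq_fun (f := fun ω : Fin k → Ω => τ (ω l)) (by fun_prop) (by fun_prop)).compl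
  rw [IsMeasurableTest, hset]
  exact (measurableSet_eq_fun ((hmeas _).comp hcons) hrange).inter (.iInter fun i =>
    (measurableSet_eq_fun ((hdrop i).comp measurable_fst) hrange).imp (hlt i))

variable {Q : Measure Ω}

theorem IsLPType.isCompressionScheme (hv : IsLPType k v) (hτ : Measurable τ)
    (hmeas : ∀ (ι : Type) [Finite ι], Measurable fun ω : ι → Ω => v (Set.range ω))
    (hnd : ∀ (ι : Type) [Fintype ι], ∀ᵐ ω ∂Measure.pi fun _ : ι => Q, IsNondegenerate v τ ω) :
    IsCompressionScheme Q k (IsCompatible v τ) where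
  isMeasurableTest := isMeasurableTest_isCompatible hτ hmeas k
  ae_existsUnique ι _ hk := (hnd ι).mono fun _ hω => hv.existsUnique_isCompatible hω hk

variable [IsProbabilityMeasure Q]

theorem IsLPType.measureReal_violation_le (hv : IsLPType (k + 1) v) (hτ : Measurable τ)
    (hmeas : ∀ (ι : Type) [Finite ι], Measurable fun ω : ι → Ω => v (Set.range ω))
    (hnd : ∀ (ι : Type) [Fintype ι], ∀ᵐ ω ∂Measure.pi fun _ : ι => Q, IsNondegenerate v τ ω)
    {ι : Type} [Fintype ι] (hk : k + 1 ≤ Fintype.card ι) {ε : ℝ} (hε : ε ∈ Set.Icc 0 1) :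
    (Measure.pi fun _ : ι => Q).real
        {ω | ε < Q.real {e | v (Set.range ω) < v (insert e (Set.range ω))}} ≤
      (binomialTail (Fintype.card ι) (k + 1)).eval ε := by
  have hG := hv.isCompressionScheme hτ hmeas hnd
  have hbound := hG.measureReal_exists_pass_le hk
    (s := 1 - ε) ⟨by linarith [hε.2], by linarith [hε.1]⟩
  rw [sub_sub_cancel] at hbound
  refine le_trans (ENNReal.toReal_mono (measure_ne_top _ _) (measure_mono_ae ?_)) hbound
  filter_upwards [hG.ae_existsUnique ι hk] with ω hω hlt
  obtain ⟨I, ⟨hI, hpass⟩, -⟩ := hω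
  have hmeasG : MeasurableSet {e | IsCompatible v τ (ω '' I) e} := by
    rw [image_eq_range_symm (I.equivFinOfCardEq hI)]
    exact measurable_prodMk_left hG.isMeasurableTest
  have hviolation : Q.real {e | v (Set.range ω) < v (insert e (Set.range ω))} ≤
      1 - Q.real {e | IsCompatible v τ (ω '' I) e} := by
    rw [← probReal_compl_eq_one_sub hmeasG]
    exact measureReal_mono fun e (he : v _ < v _) hcomp => he.ne'
      (hv.apply_insert_range_eq (fun j hj => (hpass j hj).1) hcomp.1)
  exact ⟨I, hI, by linarith [show ε < _ from hlt], hpass⟩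

end LPTypeSampling

section ConvexProgram

theorem exists_combo_lt {u w a : ℝ} (h : u < a) :
    ∃ l : ℝ, 0 < l ∧ l < 1 ∧ (1 - l) * u + l * w < a := by
  have hlim : Filter.Tendsto (fun l : ℝ => (1 - l) * u + l * w) (nhdsWithin 0 (Set.Ioi 0))
      (nhds u) :=
    (Continuous.tendsto' (by fun_prop) 0 u (by ring)).mono_left nhdsWithin_le_nhds
  obtain ⟨l, hl, hl0, hl1⟩ := ((hlim.eventually (gt_mem_nhds h)).and
    (Ioo_mem_nhdsGT (zero_lt_one (α := ℝ)))).exists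
  exact ⟨l, hl0, hl1, hl⟩

variable {E F Ω : Type*} [NormedAddCommGroup E] [NormedSpace ℝ E]
  [AddCommGroup F] [Module ℝ F]

theorem combo_mem_of_ball_subset {C : Set E} (hC : Convex ℝ C) {c y₀ y : E} {r l : ℝ}
    (hl0 : 0 < l) (hl1 : l ≤ 1) (hball : Metric.ball c r ⊆ C) (hy : y ∈ C)
    (hdist : ‖y₀ - y‖ < l * r) : (1 - l) • y₀ + l • c ∈ C := by
  have hcomb : (1 - l) • y₀ + l • c =
      (1 - l) • y + l • (c + (l⁻¹ * (1 - l)) • (y₀ - y)) := by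
    rw [smul_add, smul_smul, mul_inv_cancel_left₀ hl0.ne', smul_sub]
    abel
  have hmem : c + (l⁻¹ * (1 - l)) • (y₀ - y) ∈ Metric.ball c r := by
    rw [mem_ball_iff_norm, add_sub_cancel_left, norm_smul,
      Real.norm_of_nonneg (mul_nonneg (inv_nonneg.2 hl0.le) (sub_nonneg.2 hl1))]
    calc l⁻¹ * (1 - l) * ‖y₀ - y‖ ≤ l⁻¹ * 1 * ‖y₀ - y‖ := by gcongr; linarith
      _ < l⁻¹ * 1 * (l * r) := by gcongr
      _ = r := by field_simp
  rw [hcomb]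
  exact hC hy (hball hmem) (sub_nonneg.2 hl1) hl0.le (sub_add_cancel 1 l)

theorem nonempty_inter_iInter_of_card_le_finrank [FiniteDimensional ℝ F] {C₀ : Set F}
    {C : Ω → Set F} {s : Finset Ω} (hC₀ : Convex ℝ C₀) (hC : ∀ e ∈ s, Convex ℝ (C e))
    (hs : (⋂ e ∈ s, C e).Nonempty)
    (h : ∀ t ⊆ s, t.card ≤ Module.finrank ℝ F → (C₀ ∩ ⋂ e ∈ t, C e).Nonempty) :
    (C₀ ∩ ⋂ e ∈ s, C e).Nonempty := by
  have hHelly : (⋂ o ∈ Finset.insertNone s, o.elim C₀ C).Nonempty := by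
    refine Convex.helly_theorem' (𝕜 := ℝ) ?_ fun I hI hcard => ?_
    · rintro (_ | e) ho
      exacts [hC₀, hC e (Finset.some_mem_insertNone.1 ho)]
    have hsub : Finset.eraseNone I ⊆ s := fun e he =>
      Finset.some_mem_insertNone.1 (hI (Finset.mem_eraseNone.1 he))
    by_cases hnone : none ∈ I
    · refine (h _ hsub ?_).mono (Set.subset_iInter₂ ?_)
      · rw [Finset.card_eraseNone_of_mem hnone]
        exact Nat.sub_le_of_le_add hcard
      · rintro (_ | e) ho
        exacts [Set.inter_subset_left,
          Set.inter_subset_right.trans (Set.biInter_subset_of_mem (Finset.mem_eraseNone.2 ho))]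
    · refine hs.mono (Set.subset_iInter₂ ?_)
      rintro (_ | e) ho
      exacts [absurd ho hnone,
        Set.biInter_subset_of_mem (hsub (Finset.mem_eraseNone.2 ho))]
  obtain ⟨w, hw⟩ := hHelly
  rw [Set.mem_iInter₂] at hw
  exact ⟨w, hw none (Finset.none_mem_insertNone), Set.mem_iInter₂.2 fun e he =>
    hw (some e) (Finset.some_mem_insertNone.2 he)⟩

variable (E Ω) in
/-- A convex program with strict constraints `constraint e x < 0`, one for each `e : Ω`, such that
any finitely many of them leave a feasible region with nonempty interior. Only the values of the
functions on `domain` matter. -/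
structure ConvexProgram where
  domain : Set E
  cost : E → ℝ
  constraint : Ω → E → ℝ
  convexOn_cost : ConvexOn ℝ domain cost
  convexOn_constraint : ∀ e, ConvexOn ℝ domain (constraint e)
  bddBelow_cost : BddBelow (cost '' domain)
  slater : ∀ A : Set Ω, A.Finite →
    (interior {x | x ∈ domain ∧ ∀ e ∈ A, constraint e x < 0}).Nonempty

namespace ConvexProgram

variable (p : ConvexProgram E Ω)

/-- The points of the domain that satisfy the constraints indexed by `A`. -/
def feasible (A : Set Ω) : Set E := {x | x ∈ p.domain ∧ ∀ e ∈ A, p.constraint e x < 0}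

/-- The infimum of the cost under the constraints indexed by `A`; it need not be attained, the
constraints being strict. -/
noncomputable def value (A : Set Ω) : ℝ := sInf (p.cost '' p.feasible A)

variable {p} {A B S : Set Ω} {a : ℝ} {x y : E}

theorem feasible_subset_domain : p.feasible A ⊆ p.domain := fun _ hx => hx.1

theorem feasible_anti (h : A ⊆ B) : p.feasible B ⊆ p.feasible A :=
  fun _ hx => ⟨hx.1, fun e he => hx.2 e (h he)⟩

theorem mem_feasible_insert {e : Ω} :
    x ∈ p.feasible (insert e A) ↔ p.constraint e x < 0 ∧ x ∈ p.feasible A := by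
  simp only [feasible, Set.mem_ofPred_eq, Set.forall_mem_insert]
  tauto

theorem convex_feasible : Convex ℝ (p.feasible A) := by
  intro x hx y hy α β hα hβ hαβ
  exact ⟨p.convexOn_cost.1 hx.1 hy.1 hα hβ hαβ, fun e he =>
    ((p.convexOn_constraint e).convex_lt 0 ⟨hx.1, hx.2 e he⟩ ⟨hy.1, hy.2 e he⟩ hα hβ hαβ).2⟩

theorem nonempty_feasible (hA : A.Finite) : (p.feasible A).Nonempty :=
  (p.slater A hA).mono interior_subset

theorem value_le_cost (hx : x ∈ p.feasible A) : p.value A ≤ p.cost x :=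
  csInf_le (p.bddBelow_cost.mono (Set.image_mono feasible_subset_domain))
    (Set.mem_image_of_mem _ hx)

theorem value_lt_iff (hA : A.Finite) : p.value A < a ↔ ∃ x ∈ p.feasible A, p.cost x < a := by
  rw [value, csInf_lt_iff (p.bddBelow_cost.mono (Set.image_mono feasible_subset_domain))
    ((nonempty_feasible hA).image _), Set.exists_mem_image]

theorem value_mono (hB : B.Finite) (h : A ⊆ B) : p.value A ≤ p.value B :=
  le_csInf ((nonempty_feasible hB).image _) <| by
    rintro _ ⟨x, hx, rfl⟩
    exact value_le_cost (feasible_anti h hx)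

theorem exists_ball_subset_feasible (hA : A.Finite) :
    ∃ (c : E) (r : ℝ), 0 < r ∧ Metric.ball c r ⊆ p.feasible A := by
  obtain ⟨c, hc⟩ := p.slater A hA
  obtain ⟨r, hr, hball⟩ := Metric.isOpen_iff.1 isOpen_interior c hc
  exact ⟨c, r, hr, hball.trans interior_subset⟩

theorem apply_combo_le {s : Set E} {φ : E → ℝ} (hφ : ConvexOn ℝ s φ) {l : ℝ} (hx : x ∈ s)
    (hy : y ∈ s) (hl0 : 0 ≤ l) (hl1 : l ≤ 1) :
    φ ((1 - l) • x + l • y) ≤ (1 - l) * φ x + l * φ y :=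
  hφ.2 hx hy (sub_nonneg.2 hl1) hl0 (sub_add_cancel 1 l)

theorem sq_norm_sub_lt_of_cost_lt {m : ℝ} (hm : StrongConvexOn p.domain m p.cost)
    (hx : x ∈ p.feasible A) (hy : y ∈ p.feasible A) (hxa : p.cost x < a) (hya : p.cost y < a) :
    m / 8 * ‖x - y‖ ^ 2 < a - p.value A := by
  have hhalf : (0 : ℝ) ≤ 1 / 2 := by norm_num
  have hmid := hm.2 hx.1 hy.1 hhalf hhalf (add_halves 1)
  have hvalue := value_le_cost (convex_feasible hx hy hhalf hhalf (add_halves 1))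
  simp only [smul_eq_mul] at hmid
  linarith

theorem combo_mem_feasible_union {m r l : ℝ} {c y₀ : E}
    (hm : StrongConvexOn p.domain m p.cost) (hm0 : 0 < m) (hA : A.Finite)
    (h : ∀ e ∈ S, p.value (insert e A) = p.value A) (hr : 0 < r)
    (hball : Metric.ball c r ⊆ p.feasible (A ∪ S)) (hl0 : 0 < l) (hl1 : l ≤ 1)
    (ha : p.value A < a) (ha_dist : a ≤ p.value A + m / 8 * (l * r) ^ 2)
    (hy₀ : y₀ ∈ p.feasible A) (hy₀a : p.cost y₀ < a) :
    (1 - l) • y₀ + l • c ∈ p.feasible (A ∪ S) := by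
  have hc := hball (Metric.mem_ball_self hr)
  have hzA : (1 - l) • y₀ + l • c ∈ p.feasible A :=
    convex_feasible hy₀ (feasible_anti Set.subset_union_left hc) (sub_nonneg.2 hl1) hl0.le
      (sub_add_cancel 1 l)
  have hzS (e : Ω) (he : e ∈ S) : (1 - l) • y₀ + l • c ∈ p.feasible (insert e A) := by
    obtain ⟨y, hy, hya⟩ := (value_lt_iff (hA.insert e)).1 ((h e he).trans_lt ha)
    have hsq := sq_norm_sub_lt_of_cost_lt hm hy₀ (feasible_anti (Set.subset_insert e A) hy)
      hy₀a hya
    have hdist : ‖y₀ - y‖ < l * r := lt_of_pow_lt_pow_left₀ 2 (by positivity)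
      (lt_of_mul_lt_mul_left (hsq.trans_le (by linarith)) (by positivity))
    have hsub : insert e A ⊆ A ∪ S := Set.insert_subset (Or.inr he) Set.subset_union_left
    exact combo_mem_of_ball_subset convex_feasible hl0 hl1 (hball.trans (feasible_anti hsub))
      hy hdist
  refine ⟨hzA.1, ?_⟩
  rintro e (he | he)
  · exact hzA.2 e he
  · exact (hzS e he).2 e (Set.mem_insert e A)

theorem value_union_eq {m : ℝ} (hm : StrongConvexOn p.domain m p.cost) (hm0 : 0 < m)
    (hA : A.Finite) (hS : S.Finite) (h : ∀ e ∈ S, p.value (insert e A) = p.value A) :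
    p.value (A ∪ S) = p.value A := by
  refine le_antisymm ?_ (value_mono (hA.union hS) Set.subset_union_left)
  by_contra! hlt
  obtain ⟨c, r, hr, hball⟩ := exists_ball_subset_feasible (p := p) (hA.union hS)
  have hc := hball (Metric.mem_ball_self hr)
  obtain ⟨l, hl0, hl1, hl⟩ := exists_combo_lt (w := p.cost c) hlt
  have h1l : 0 < 1 - l := sub_pos.2 hl1
  obtain ⟨a, ha, ha_dist, ha_cost⟩ : ∃ a, p.value A < a ∧
      a ≤ p.value A + m / 8 * (l * r) ^ 2 ∧ (1 - l) * a + l * p.cost c ≤ p.value (A ∪ S) := by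
    refine ⟨min (p.value A + m / 8 * (l * r) ^ 2)
      ((p.value (A ∪ S) - l * p.cost c) / (1 - l)), lt_min (lt_add_of_pos_right _ (by positivity))
      ((lt_div_iff₀ h1l).2 (by linarith)), min_le_left _ _, ?_⟩
    linarith [(le_div_iff₀' h1l).1 (min_le_right (p.value A + m / 8 * (l * r) ^ 2)
      ((p.value (A ∪ S) - l * p.cost c) / (1 - l)))]
  obtain ⟨y₀, hy₀, hy₀a⟩ := (value_lt_iff hA).1 ha
  have hz := combo_mem_feasible_union hm hm0 hA h hr hball hl0 hl1.le ha ha_dist hy₀ hy₀a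
  exact lt_irrefl _ <| calc
    p.value (A ∪ S) ≤ p.cost ((1 - l) • y₀ + l • c) := value_le_cost hz
    _ ≤ (1 - l) * p.cost y₀ + l * p.cost c :=
      apply_combo_le p.convexOn_cost hy₀.1 hc.1 hl0.le hl1.le
    _ < (1 - l) * a + l * p.cost c := by gcongr
    _ ≤ p.value (A ∪ S) := ha_cost

theorem value_eq_of_value_insert_eq {e e' : Ω} {s : ℝ} (hs : 0 < s)
    (hgap : ∀ x ∈ p.domain, p.constraint e' x + s ≤ p.constraint e x) (hA : A.Finite)
    (h : p.value (insert e A) = p.value (insert e' A)) : p.value A = p.value (insert e A) := by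
  refine le_antisymm (value_mono (hA.insert e) (Set.subset_insert e A)) ?_
  by_contra! hlt
  obtain ⟨y, hy, hyw⟩ := (value_lt_iff hA).1 hlt
  obtain ⟨l, hl0, hl1, hl⟩ := exists_combo_lt (w := p.constraint e' y) (neg_lt_zero.2 hs)
  have h1l : 0 < 1 - l := sub_pos.2 hl1
  have hlow : p.value (insert e A) < (p.value (insert e A) - l * p.cost y) / (1 - l) := by
    rw [lt_div_iff₀ h1l]
    linarith [mul_lt_mul_of_pos_left hyw hl0]
  obtain ⟨x, hx, hxw⟩ := (value_lt_iff (hA.insert e)).1 hlow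
  rw [lt_div_iff₀' h1l] at hxw
  rw [mem_feasible_insert] at hx
  have hz : (1 - l) • x + l • y ∈ p.feasible (insert e' A) := by
    refine mem_feasible_insert.2 ⟨?_, convex_feasible hx.2 hy h1l.le hl0.le (sub_add_cancel 1 l)⟩
    calc p.constraint e' ((1 - l) • x + l • y)
        ≤ (1 - l) * p.constraint e' x + l * p.constraint e' y :=
          apply_combo_le (p.convexOn_constraint e') hx.2.1 hy.1 hl0.le hl1.le
      _ ≤ (1 - l) * -s + l * p.constraint e' y := by
          gcongr
          linarith [hgap x hx.2.1, hx.1]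
      _ < 0 := hl
  have hvalue := value_le_cost hz
  have hcost := apply_combo_le p.convexOn_cost hx.2.1 hy.1 hl0.le hl1.le
  linarith

theorem iInter_image_nonempty_of_value_lt (L : E →ₗ[ℝ] F) (hB : B.Finite)
    (h : p.value B < a) :
    (L '' {x | x ∈ p.domain ∧ p.cost x < a} ∩
      ⋂ e ∈ B, L '' {x | x ∈ p.domain ∧ p.constraint e x < 0}).Nonempty := by
  obtain ⟨x, hx, hxa⟩ := (value_lt_iff hB).1 h
  exact ⟨L x, ⟨x, ⟨hx.1, hxa⟩, rfl⟩, Set.mem_iInter₂.2 fun e he => ⟨x, ⟨hx.1, hx.2 e he⟩, rfl⟩⟩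

theorem value_lt_of_iInter_image_nonempty {L : E →ₗ[ℝ] F}
    (hL : ∀ e, ∀ x ∈ p.domain, ∀ y ∈ p.domain, L x = L y → p.constraint e x = p.constraint e y)
    (hA : A.Finite)
    (h : (L '' {x | x ∈ p.domain ∧ p.cost x < a} ∩
      ⋂ e ∈ A, L '' {x | x ∈ p.domain ∧ p.constraint e x < 0}).Nonempty) :
    p.value A < a := by
  obtain ⟨w, ⟨x, ⟨hx, hxa⟩, hxw⟩, hw⟩ := h
  refine (value_lt_iff hA).2 ⟨x, ⟨hx, fun e he => ?_⟩, hxa⟩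
  obtain ⟨y, ⟨hy, hye⟩, hyw⟩ := Set.mem_iInter₂.1 hw e he
  exact (hL e x hx y hy (hxw.trans hyw.symm)).trans_lt hye

variable [FiniteDimensional ℝ F]

theorem exists_basis {L : E →ₗ[ℝ] F}
    (hL : ∀ e, ∀ x ∈ p.domain, ∀ y ∈ p.domain, L x = L y → p.constraint e x = p.constraint e y)
    (hA : A.Finite) : ∃ B ⊆ A, B.ncard ≤ Module.finrank ℝ F ∧ p.value B = p.value A := by
  by_contra! hne
  have hlt (t : Finset Ω) (ht : t ⊆ hA.toFinset) (hcard : t.card ≤ Module.finrank ℝ F) :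
      p.value t < p.value A := by
    have htA : (t : Set Ω) ⊆ A := by simpa only [Set.Finite.subset_toFinset] using ht
    exact lt_of_le_of_ne (value_mono hA htA) (hne t htA (by rwa [Set.ncard_coe_finset]))
  have hinter := nonempty_inter_iInter_of_card_le_finrank (s := hA.toFinset)
    ((p.convexOn_cost.convex_lt (p.value A)).linear_image L)
    (fun e _ => ((p.convexOn_constraint e).convex_lt 0).linear_image L)
    ((iInter_image_nonempty_of_value_lt L (hA.toFinset.finite_toSet) (lt_add_one _)).mono
      Set.inter_subset_right)
    fun t ht hcard => iInter_image_nonempty_of_value_lt L t.finite_toSet (hlt t ht hcard)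
  simp only [Set.Finite.mem_toFinset] at hinter
  exact (value_lt_of_iInter_image_nonempty hL hA hinter).false

theorem isLPType_value {m : ℝ} (hm : StrongConvexOn p.domain m p.cost) (hm0 : 0 < m)
    {L : E →ₗ[ℝ] F}
    (hL : ∀ e, ∀ x ∈ p.domain, ∀ y ∈ p.domain, L x = L y →
      p.constraint e x = p.constraint e y) :
    IsLPType (Module.finrank ℝ F) p.value where
  mono _ _ hB h := value_mono hB h
  basis _ hA := exists_basis hL hA
  locality _ _ hA hS h := value_union_eq hm hm0 hA hS h

variable [FiniteDimensional ℝ E]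

theorem value_lt_iff_denseSeq (hA : A.Finite) :
    p.value A < a ↔ ∃ n, TopologicalSpace.denseSeq E n ∈ p.feasible A ∧
      p.cost (TopologicalSpace.denseSeq E n) < a := by
  refine ⟨fun h => ?_, fun ⟨n, hn⟩ => (value_lt_iff hA).2 ⟨_, hn⟩⟩
  obtain ⟨x, hx, hxa⟩ := (value_lt_iff hA).1 h
  obtain ⟨c, hc⟩ := p.slater A hA
  obtain ⟨l, hl0, hl1, hl⟩ := exists_combo_lt (w := p.cost c) hxa
  have hz : (1 - l) • x + l • c ∈ interior (p.feasible A) :=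
    convex_feasible.combo_self_interior_mem_interior hx hc (sub_nonneg.2 hl1.le) hl0
      (sub_add_cancel 1 l)
  have hcost : p.cost ((1 - l) • x + l • c) < a :=
    (apply_combo_le p.convexOn_cost hx.1 (interior_subset hc).1 hl0.le hl1.le).trans_lt hl
  have hcont : ContinuousAt p.cost ((1 - l) • x + l • c) :=
    p.convexOn_cost.continuousOn_interior.continuousAt <|
      isOpen_interior.mem_nhds (interior_mono feasible_subset_domain hz)
  obtain ⟨_, ⟨n, rfl⟩, hn, hna⟩ := ((mem_closure_iff_frequently.1
    (TopologicalSpace.denseRange_denseSeq E _)).and_eventually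
      ((isOpen_interior.eventually_mem hz).and (hcont.eventually (gt_mem_nhds hcost)))).exists
  exact ⟨n, interior_subset hn, hna⟩

theorem measurable_value_range [MeasurableSpace Ω]
    (hmeas : ∀ x ∈ p.domain, Measurable fun e => p.constraint e x) {ι : Type*} [Finite ι] :
    Measurable fun ω : ι → Ω => p.value (Set.range ω) := by
  refine measurable_of_Iio fun a => ?_
  have hpre : (fun ω : ι → Ω => p.value (Set.range ω)) ⁻¹' Set.Iio a =
      ⋃ n, {ω | TopologicalSpace.denseSeq E n ∈ p.feasible (Set.range ω) ∧
        p.cost (TopologicalSpace.denseSeq E n) < a} := by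
    ext ω
    simp only [Set.mem_preimage, Set.mem_Iio, value_lt_iff_denseSeq (Set.finite_range ω),
      Set.mem_iUnion, Set.mem_ofPred_eq]
  rw [hpre]
  refine .iUnion fun n => ?_
  simp only [feasible, Set.mem_ofPred_eq, Set.forall_mem_range]
  by_cases hn : TopologicalSpace.denseSeq E n ∈ p.domain
  · exact ((MeasurableSet.const _).inter (measurableSet_setOfPred.2 <| .forall fun i =>
      measurableSet_setOfPred.1 <| measurableSet_lt ((hmeas _ hn).comp (measurable_pi_apply i))
        measurable_const)).inter (.const _)
  · simp only [hn, false_and, Set.ofPred_false, MeasurableSet.empty]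

end ConvexProgram

end ConvexProgram

section ConvexScenario

variable {E F Δ : Type*} [NormedAddCommGroup E] [InnerProductSpace ℝ E]

variable (E Δ) in
/-- A convex program over a bounded domain with constraints `constraint δ x ≤ 0`, one for each
scenario `δ : Δ`, such that any finitely many of them leave a feasible region with nonempty
interior. Only the values of the functions on `domain` matter. -/
structure ConvexScenario where
  domain : Set E
  cost : E → ℝ
  constraint : Δ → E → ℝ
  convexOn_cost : ConvexOn ℝ domain cost
  convexOn_constraint : ∀ δ, ConvexOn ℝ domain (constraint δ)
  cost_nonneg : ∀ x ∈ domain, 0 ≤ cost x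
  isBounded_domain : Bornology.IsBounded domain
  slater : ∀ D : Set Δ, D.Finite →
    (interior {x | x ∈ domain ∧ ∀ δ ∈ D, constraint δ x ≤ 0}).Nonempty

namespace ConvexScenario

variable (p : ConvexScenario E Δ)

/-- The points of the domain that satisfy the constraints of the scenarios in `D`. -/
def feasible (D : Set Δ) : Set E := {x | x ∈ p.domain ∧ ∀ δ ∈ D, p.constraint δ x ≤ 0}

/-- The perturbation of size `ρ` of a scenario program. A scenario comes with a label `t`, and its
constraint is relaxed by `ρ * exp t`: with random labels no two subsamples have the same value by
accident. The term `ρ * ‖x‖ ^ 2` makes the cost strongly convex. -/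
noncomputable def relax {ρ : ℝ} (hρ : 0 < ρ) : ConvexProgram E (Δ × ℝ) where
  domain := p.domain
  cost x := p.cost x + ρ * ‖x‖ ^ 2
  constraint e x := p.constraint e.1 x - ρ * Real.exp e.2
  convexOn_cost := p.convexOn_cost.add <|
    ((convexOn_norm p.convexOn_cost.1).pow (fun _ _ => norm_nonneg _) 2).smul hρ.le
  convexOn_constraint e := (p.convexOn_constraint e.1).sub (concaveOn_const _ p.convexOn_cost.1)
  bddBelow_cost := ⟨0, by
    rintro _ ⟨x, hx, rfl⟩
    exact add_nonneg (p.cost_nonneg x hx) (by positivity)⟩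
  slater A hA := (p.slater (Prod.fst '' A) (hA.image _)).mono <| interior_mono fun x hx =>
    ⟨hx.1, fun e he => sub_neg.2 ((hx.2 e.1 ⟨e, he, rfl⟩).trans_lt (by positivity))⟩

variable {p} {ρ : ℝ} {A : Set (Δ × ℝ)} {a : ℝ}

theorem feasible_subset_feasible_relax (hρ : 0 < ρ) :
    p.feasible (Prod.fst '' A) ⊆ (p.relax hρ).feasible A :=
  fun _ hx => ⟨hx.1, fun e he =>
    sub_neg.2 ((hx.2 e.1 ⟨e, he, rfl⟩).trans_lt (by positivity))⟩

theorem strongConvexOn_cost_relax (hρ : 0 < ρ) :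
    StrongConvexOn (p.relax hρ).domain (2 * ρ) (p.relax hρ).cost := by
  rw [strongConvexOn_iff_convex]
  refine p.convexOn_cost.congr fun x _ => ?_
  simp only [relax]
  ring

theorem value_relax_eq_of_value_insert_eq (hρ : 0 < ρ) (hA : A.Finite) {δ : Δ} {t t' : ℝ}
    (htt' : t ≠ t')
    (h : (p.relax hρ).value (insert (δ, t) A) = (p.relax hρ).value (insert (δ, t') A)) :
    (p.relax hρ).value A = (p.relax hρ).value (insert (δ, t) A) := by
  wlog hlt : t < t' generalizing t t'
  · exact (this htt'.symm h.symm (htt'.lt_or_gt.resolve_left hlt)).trans h.symm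
  · refine ConvexProgram.value_eq_of_value_insert_eq (s := ρ * (Real.exp t' - Real.exp t))
      (mul_pos hρ (sub_pos.2 (Real.exp_lt_exp.2 hlt))) (fun x _ => ?_) hA h
    simp only [relax]
    linarith

theorem isLPType_value_relax [AddCommGroup F] [Module ℝ F] [FiniteDimensional ℝ F]
    (hρ : 0 < ρ) {L : E →ₗ[ℝ] F}
    (hL : ∀ δ, ∀ x ∈ p.domain, ∀ y ∈ p.domain, L x = L y →
      p.constraint δ x = p.constraint δ y) :
    IsLPType (Module.finrank ℝ F) (p.relax hρ).value :=
  ConvexProgram.isLPType_value (strongConvexOn_cost_relax hρ) (by positivity)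
    fun e x hx y hy hxy => congrArg (· - ρ * Real.exp e.2) (hL e.1 x hx y hy hxy)

theorem constraint_nonpos_of_finrank_eq_zero [AddCommGroup F] [Module ℝ F]
    [FiniteDimensional ℝ F] {L : E →ₗ[ℝ] F}
    (hL : ∀ δ, ∀ x ∈ p.domain, ∀ y ∈ p.domain, L x = L y →
      p.constraint δ x = p.constraint δ y)
    (hF : Module.finrank ℝ F = 0) {x : E} (hx : x ∈ p.domain) (δ : Δ) :
    p.constraint δ x ≤ 0 := by
  have := Module.finrank_zero_iff.1 hF
  obtain ⟨c, hc⟩ := (p.slater {δ} (Set.finite_singleton δ)).mono interior_subset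
  exact (hL δ x hx c hc.1 (Subsingleton.elim _ _)).trans_le (hc.2 δ rfl)

theorem eventually_value_relax_lt {r : ℕ → ℝ} (hr : ∀ n, 0 < r n)
    (hlim : Filter.Tendsto r Filter.atTop (nhds 0)) {x : E} (hx : x ∈ p.feasible (Prod.fst '' A))
    (ha : p.cost x < a) : ∀ᶠ n in Filter.atTop, (p.relax (hr n)).value A < a := by
  have hcost : Filter.Tendsto (fun n => p.cost x + r n * ‖x‖ ^ 2) Filter.atTop
      (nhds (p.cost x)) := by
    simpa only [zero_mul, add_zero] using (hlim.mul_const (‖x‖ ^ 2)).const_add (p.cost x)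
  filter_upwards [hcost.eventually (gt_mem_nhds ha)] with n hn
  exact (ConvexProgram.value_le_cost (feasible_subset_feasible_relax (hr n) hx)).trans_lt hn

variable [FiniteDimensional ℝ E]

theorem measurable_value_relax [MeasurableSpace Δ] (hρ : 0 < ρ)
    (hmeas : ∀ x ∈ p.domain, Measurable fun δ => p.constraint δ x) {ι : Type*} [Finite ι] :
    Measurable fun ω : ι → Δ × ℝ => (p.relax hρ).value (Set.range ω) :=
  ConvexProgram.measurable_value_range fun x hx =>
    ((hmeas x hx).comp measurable_fst).sub (by fun_prop)

theorem apply_combo_le_of_tendsto {s : Set E} {φ : E → ℝ} (hφ : ConvexOn ℝ s φ) {x : ℕ → E}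
    {x' c : E} (hx : ∀ n, x n ∈ s) (hlim : Filter.Tendsto x Filter.atTop (nhds x'))
    (hc : c ∈ interior s) {l : ℝ} (hl0 : 0 < l) (hl1 : l ≤ 1) {u : ℕ → ℝ} {u' : ℝ}
    (hu : Filter.Tendsto u Filter.atTop (nhds u')) (h : ∀ n, φ (x n) ≤ u n) :
    φ ((1 - l) • x' + l • c) ≤ (1 - l) * u' + l * φ c := by
  have hmem : (1 - l) • x' + l • c ∈ interior s :=
    hφ.1.combo_closure_interior_mem_interior
      (mem_closure_of_tendsto hlim (.of_forall hx)) hc (sub_nonneg.2 hl1) hl0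
      (sub_add_cancel 1 l)
  have hcont : ContinuousAt φ ((1 - l) • x' + l • c) :=
    hφ.continuousOn_interior.continuousAt (isOpen_interior.mem_nhds hmem)
  refine le_of_tendsto_of_tendsto'
    (hcont.tendsto.comp ((hlim.const_smul (1 - l)).add_const (l • c)))
    ((hu.const_mul (1 - l)).add_const (l * φ c)) fun n => ?_
  calc φ ((1 - l) • x n + l • c) ≤ (1 - l) * φ (x n) + l * φ c :=
        ConvexProgram.apply_combo_le hφ (hx n) (interior_subset hc) hl0.le hl1
    _ ≤ (1 - l) * u n + l * φ c := by
        gcongr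
        exact h n

theorem exists_feasible_cost_lt {r : ℕ → ℝ} (hr : ∀ n, 0 < r n)
    (hlim : Filter.Tendsto r Filter.atTop (nhds 0)) (hA : A.Finite) {b : ℝ} (hab : a < b)
    (h : ∀ n, (p.relax (hr n)).value A < a) : ∃ x ∈ p.feasible (Prod.fst '' A), p.cost x < b := by
  choose x hx hxa using fun n => (ConvexProgram.value_lt_iff hA).1 (h n)
  obtain ⟨x', -, ψ, hψ, hx'⟩ := p.isBounded_domain.isCompact_closure.tendsto_subseq
    fun n => subset_closure (hx n).1
  obtain ⟨c, hc⟩ := p.slater (Prod.fst '' A) (hA.image _)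
  have hcdom : c ∈ interior p.domain := interior_mono (fun _ hy => hy.1) hc
  obtain ⟨l, hl0, hl1, hl⟩ := exists_combo_lt (w := p.cost c) hab
  refine ⟨(1 - l) • x' + l • c, ⟨?_, ?_⟩, ?_⟩
  · exact interior_subset <| p.convexOn_cost.1.combo_closure_interior_mem_interior
      (mem_closure_of_tendsto hx' (.of_forall fun n => (hx (ψ n)).1)) hcdom (sub_nonneg.2 hl1.le)
      hl0 (sub_add_cancel 1 l)
  · rintro _ ⟨e, he, rfl⟩
    have hrlim : Filter.Tendsto (fun n => r (ψ n) * Real.exp e.2) Filter.atTop (nhds 0) := by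
      simpa only [zero_mul, Function.comp_apply] using
        (hlim.comp hψ.tendsto_atTop).mul_const (Real.exp e.2)
    have hce : p.constraint e.1 c ≤ 0 := (interior_subset hc).2 e.1 ⟨e, he, rfl⟩
    calc p.constraint e.1 ((1 - l) • x' + l • c) ≤ (1 - l) * 0 + l * p.constraint e.1 c :=
          apply_combo_le_of_tendsto (p.convexOn_constraint e.1) (fun n => (hx (ψ n)).1) hx' hcdom
            hl0 hl1.le hrlim fun n => (sub_neg.1 ((hx (ψ n)).2 e he)).le
      _ ≤ 0 := by nlinarith
  · refine lt_of_le_of_lt ?_ hl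
    refine apply_combo_le_of_tendsto p.convexOn_cost (fun n => (hx (ψ n)).1) hx' hcdom hl0 hl1.le
      tendsto_const_nhds fun n => ?_
    exact (le_add_of_nonneg_right (mul_nonneg (hr _).le (sq_nonneg _))).trans (hxa (ψ n)).le

theorem eventually_le_value_relax {r : ℕ → ℝ} (hr : ∀ n, 0 < r n)
    (hlim : Filter.Tendsto r Filter.atTop (nhds 0)) (hA : A.Finite) {b : ℝ} (hab : a < b)
    (hb : ∀ x ∈ p.feasible (Prod.fst '' A), b ≤ p.cost x) :
    ∀ᶠ n in Filter.atTop, a ≤ (p.relax (hr n)).value A := by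
  by_contra hcon
  simp only [Filter.not_eventually, not_le] at hcon
  obtain ⟨φ, hφ, hlt⟩ := Filter.extraction_of_frequently_atTop hcon
  obtain ⟨x, hx, hxb⟩ :=
    exists_feasible_cost_lt (fun n => hr (φ n)) (hlim.comp hφ.tendsto_atTop) hA hab hlt
  exact (hb x hx).not_gt hxb

end ConvexScenario

end ConvexScenario

section Perturbation

theorem eventually_lt_measureReal {α : Type*} [MeasurableSpace α] {μ : Measure α}
    [IsFiniteMeasure μ] {S : Set α} {s : ℕ → Set α}
    (h : ∀ x ∈ S, ∀ᶠ n in Filter.atTop, x ∈ s n) {c : ℝ} (hc : c < μ.real S) :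
    ∀ᶠ n in Filter.atTop, c < μ.real (s n) := by
  have hmono : Monotone fun m => ⋂ n ≥ m, s n := fun m m' hm =>
    Set.biInter_subset_biInter_left fun n hn => hm.trans hn
  have hS : S ⊆ ⋃ m, ⋂ n ≥ m, s n := fun x hx => by
    simpa only [Set.mem_iUnion, Set.mem_iInter] using Filter.eventually_atTop.1 (h x hx)
  have hlim : Filter.Tendsto (fun m => μ.real (⋂ n ≥ m, s n)) Filter.atTop
      (nhds (μ.real (⋃ m, ⋂ n ≥ m, s n))) :=
    (ENNReal.tendsto_toReal (measure_ne_top _ _)).comp (tendsto_measure_iUnion_atTop hmono)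
  filter_upwards [hlim.eventually (lt_mem_nhds (hc.trans_le (measureReal_mono hS)))] with m hm
  exact hm.trans_le (measureReal_mono (Set.biInter_subset_of_mem (le_refl m)))

variable {Δ ι : Type*} [MeasurableSpace Δ] [Fintype ι]

theorem pi_eq_zero_of_update {Ω : Type*} [MeasurableSpace Ω] {Q : Measure Ω}
    [IsProbabilityMeasure Q] [DecidableEq ι] {s : Set (ι → Ω)} (hs : MeasurableSet s) (j : ι)
    (h : ∀ ω : ι → Ω, Q {e | Function.update ω j e ∈ s} = 0) :
    Measure.pi (fun _ : ι => Q) s = 0 := by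
  obtain ⟨x₀⟩ := nonempty_of_isProbabilityMeasure Q
  have hslice (ω : ι → Ω) :
      ∫⁻ e, s.indicator 1 (Function.update ω j e) ∂Q = (0 : ENNReal) :=
    (lintegral_indicator_one (measurable_update ω hs)).trans (h ω)
  rw [← lintegral_indicator_one hs, lintegral_eq_lmarginal_univ fun _ => x₀,
    lmarginal_erase' _ (measurable_one.indicator hs) (Finset.mem_univ j)]
  simp only [hslice, lmarginal, lintegral_zero]

variable {P : Measure Δ} [IsProbabilityMeasure P] {μ : Measure ℝ} [IsProbabilityMeasure μ]

theorem pi_prod_eq_zero_of_subsingleton_labels [NullSingletonClass μ] [DecidableEq ι]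
    {s : Set (ι → Δ × ℝ)} (hs : MeasurableSet s) (j : ι)
    (h : ∀ (ω : ι → Δ × ℝ) (δ : Δ), {t | Function.update ω j (δ, t) ∈ s}.Subsingleton) :
    Measure.pi (fun _ : ι => P.prod μ) s = 0 :=
  pi_eq_zero_of_update hs j fun ω => (Measure.measure_prod_null (measurable_update ω hs)).2 <|
    .of_forall fun δ => (h ω δ).measure_zero μ

theorem ae_injective_labels [NullSingletonClass μ] :
    ∀ᵐ ω ∂Measure.pi fun _ : ι => P.prod μ, Function.Injective (Prod.snd ∘ ω) := by
  classical
  have hne (i j : ι) (hij : i ≠ j) :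
      ∀ᵐ ω ∂Measure.pi fun _ : ι => P.prod μ, (ω i).2 ≠ (ω j).2 := by
    have hs : MeasurableSet {ω : ι → Δ × ℝ | (ω i).2 = (ω j).2} :=
      measurableSet_eq_fun (by fun_prop) (by fun_prop)
    refine measure_eq_zero_iff_ae_notMem.1
      (pi_prod_eq_zero_of_subsingleton_labels hs j fun ω δ t ht t' ht' => ?_)
    have hlabel (u : ℝ) (hu : Function.update ω j (δ, u) ∈ {ω | (ω i).2 = (ω j).2}) :
        (ω i).2 = u := by
      simpa only [Set.mem_ofPred_eq, Function.update_self, Function.update_of_ne hij] using hu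
    exact (hlabel t ht).symm.trans (hlabel t' ht')
  filter_upwards [ae_all_iff.2 fun i => ae_all_iff.2 fun j =>
    Filter.eventually_imp_distrib_left.2 (hne i j)] with ω hω i j hij
  exact not_imp_not.1 (hω i j) hij

theorem pi_prod_preimage_fst (S : Set (ι → Δ)) :
    Measure.pi (fun _ : ι => P.prod μ) ((fun ω i => (ω i).1) ⁻¹' S) =
      Measure.pi (fun _ : ι => P) S := by
  have h := (measurePreserving_arrowProdEquivProdArrow Δ ℝ ι (fun _ => P)
    fun _ => μ).measure_preimage_equiv (S ×ˢ Set.univ)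
  rw [Measure.prod_prod, measure_univ, mul_one, Set.prod_univ] at h
  exact h

end Perturbation

namespace ConvexScenario

variable {E F Δ : Type*} [NormedAddCommGroup E] [InnerProductSpace ℝ E] [FiniteDimensional ℝ E]
  {p : ConvexScenario E Δ}

theorem eventually_value_relax_lt_value_relax_insert {r : ℕ → ℝ} (hr : ∀ n, 0 < r n)
    (hlim : Filter.Tendsto r Filter.atTop (nhds 0)) {A : Set (Δ × ℝ)} (hA : A.Finite)
    {e : Δ × ℝ} {x : E} (hx : x ∈ p.feasible (Prod.fst '' A))
    (hstrict : ∃ b, p.cost x < b ∧ ∀ y ∈ p.feasible (insert e.1 (Prod.fst '' A)), b ≤ p.cost y) :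
    ∀ᶠ n in Filter.atTop, (p.relax (hr n)).value A < (p.relax (hr n)).value (insert e A) := by
  obtain ⟨b, hxb, hb⟩ := hstrict
  rw [← Set.image_insert_eq] at hb
  obtain ⟨a, hxa, hab⟩ := exists_between hxb
  filter_upwards [eventually_value_relax_lt hr hlim hx hxa,
    eventually_le_value_relax hr hlim (hA.insert e) hab hb] with n hlt hle
  exact hlt.trans_le hle

variable [MeasurableSpace Δ] {P : Measure Δ} [IsProbabilityMeasure P] {ρ : ℝ}

theorem ae_isNondegenerate_relax {μ : Measure ℝ} [IsProbabilityMeasure μ] [NullSingletonClass μ]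
    (hρ : 0 < ρ) (hmeas : ∀ x ∈ p.domain, Measurable fun δ => p.constraint δ x)
    {ι : Type} [Fintype ι] :
    ∀ᵐ ω ∂Measure.pi fun _ : ι => P.prod μ, IsNondegenerate (p.relax hρ).value Prod.snd ω := by
  classical
  have hvalue (I : Set ι) : Measurable fun ω : ι → Δ × ℝ => (p.relax hρ).value (ω '' I) :=
    measurable_apply_image (fun _ _ => measurable_value_relax hρ hmeas) fun _ => .const _
  have hdrop (I K : Set ι) (j : ι) (hjI : j ∈ I) (hjK : j ∉ K) :
      ∀ᵐ ω ∂Measure.pi fun _ : ι => P.prod μ,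
        ω ∉ {ω | (p.relax hρ).value (ω '' I) = (p.relax hρ).value (ω '' K) ∧
          (p.relax hρ).value (ω '' (I \ {j})) ≠ (p.relax hρ).value (ω '' I)} := by
    refine measure_eq_zero_iff_ae_notMem.1 (pi_prod_eq_zero_of_subsingleton_labels
      ((measurableSet_eq_fun (hvalue I) (hvalue K)).inter
        (measurableSet_eq_fun (hvalue _) (hvalue I)).compl) j fun ω δ t ht t' ht' => ?_)
    by_contra hne
    have himage (e : Δ × ℝ) (S : Set ι) (hjS : j ∉ S) : Function.update ω j e '' S = ω '' S :=
      Set.image_congr fun i hi => Function.update_of_ne (ne_of_mem_of_not_mem hi hjS) _ _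
    have hinsert (e : Δ × ℝ) :
        Function.update ω j e '' I = insert e (ω '' (I \ {j})) := by
      rw [← himage e (I \ {j}) fun h => h.2 rfl]
      conv_lhs => rw [← Set.insert_sdiff_self_of_mem hjI, Set.image_insert_eq,
        Function.update_self]
    simp only [Set.mem_ofPred_eq, hinsert, himage _ K hjK,
      himage _ (I \ {j}) fun h => h.2 rfl] at ht ht'
    exact ht.2 (value_relax_eq_of_value_insert_eq hρ (Set.toFinite _) hne
      (ht.1.trans ht'.1.symm))
  have hdrop_all : ∀ᵐ ω ∂Measure.pi fun _ : ι => P.prod μ, ∀ I K : Set ι, ∀ j ∈ I, j ∉ K →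
      (p.relax hρ).value (ω '' I) = (p.relax hρ).value (ω '' K) →
        (p.relax hρ).value (ω '' (I \ {j})) = (p.relax hρ).value (ω '' I) := by
    simp only [ae_all_iff, Filter.eventually_imp_distrib_left]
    intro I K j hjI hjK
    filter_upwards [hdrop I K j hjI hjK] with ω hω heq
    exact not_not.1 fun hne => hω ⟨heq, hne⟩
  filter_upwards [ae_injective_labels, hdrop_all] with ω hinj hω using ⟨hinj, hω⟩

variable [AddCommGroup F] [Module ℝ F] [FiniteDimensional ℝ F] {L : E →ₗ[ℝ] F}
  {ι : Type} [Fintype ι] {ε : ℝ}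

theorem measureReal_violation_relax_le {μ : Measure ℝ} [IsProbabilityMeasure μ]
    [NullSingletonClass μ] (hρ : 0 < ρ)
    (hL : ∀ δ, ∀ x ∈ p.domain, ∀ y ∈ p.domain, L x = L y → p.constraint δ x = p.constraint δ y)
    (hmeas : ∀ x ∈ p.domain, Measurable fun δ => p.constraint δ x) (hF : Module.finrank ℝ F ≠ 0)
    (hcard : Module.finrank ℝ F ≤ Fintype.card ι) (hε : ε ∈ Set.Icc 0 1) :
    (Measure.pi fun _ : ι => P.prod μ).real {ω | ε < (P.prod μ).real
      {e | (p.relax hρ).value (Set.range ω) < (p.relax hρ).value (insert e (Set.range ω))}} ≤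
      (binomialTail (Fintype.card ι) (Module.finrank ℝ F)).eval ε := by
  have hlp := isLPType_value_relax (p := p) hρ hL
  obtain ⟨k, hk⟩ := Nat.exists_eq_succ_of_ne_zero hF
  rw [hk] at hlp hcard ⊢
  exact hlp.measureReal_violation_le measurable_snd
    (fun _ _ => measurable_value_relax hρ hmeas) (fun _ _ => ae_isNondegenerate_relax hρ hmeas)
    hcard hε

theorem measureReal_violation_le
    (hL : ∀ δ, ∀ x ∈ p.domain, ∀ y ∈ p.domain, L x = L y → p.constraint δ x = p.constraint δ y)
    (hmeas : ∀ x ∈ p.domain, Measurable fun δ => p.constraint δ x)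
    (hcard : Module.finrank ℝ F ≤ Fintype.card ι) (hε : ε ∈ Set.Icc 0 1) {x : (ι → Δ) → E}
    (hx : ∀ ω, x ω ∈ p.feasible (Set.range ω))
    (hstrict : Nonempty ι → ∀ ω δ, 0 < p.constraint δ (x ω) →
      ∃ b, p.cost (x ω) < b ∧ ∀ y ∈ p.feasible (insert δ (Set.range ω)), b ≤ p.cost y) :
    (Measure.pi fun _ : ι => P).real {ω | ε < P.real {δ | 0 < p.constraint δ (x ω)}} ≤
      (binomialTail (Fintype.card ι) (Module.finrank ℝ F)).eval ε := by
  rcases eq_or_ne (Module.finrank ℝ F) 0 with hF | hF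
  · have hnone (ω : ι → Δ) : {δ | 0 < p.constraint δ (x ω)} = ∅ :=
      Set.eq_empty_of_forall_notMem fun δ hδ =>
        (constraint_nonpos_of_finrank_eq_zero hL hF (hx ω).1 δ).not_gt hδ
    simp only [hnone, measureReal_empty, hε.1.not_gt, Set.ofPred_false, hF, eval_binomialTail,
      Finset.range_zero, Finset.sum_empty, le_refl]
  have hι : Nonempty ι := Fintype.card_pos_iff.1 ((Nat.pos_of_ne_zero hF).trans_le hcard)
  set μ : Measure ℝ := volume.restrict (Set.Icc 0 1)
  have : IsProbabilityMeasure μ := ⟨by simp [μ]⟩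
  have hr (n : ℕ) : (0 : ℝ) < 1 / (n + 1) := Nat.one_div_pos_of_nat
  have hPμ (S : Set Δ) : (P.prod μ).real (Prod.fst ⁻¹' S) = P.real S := by
    rw [← Set.prod_univ, measureReal_prod_prod, probReal_univ, mul_one]
  by_contra! hlt
  rw [measureReal_def, ← pi_prod_preimage_fst (μ := μ), ← measureReal_def] at hlt
  have hconverge : ∀ ω ∈ (fun (ω : ι → Δ × ℝ) i => (ω i).1) ⁻¹'
      {ω | ε < P.real {δ | 0 < p.constraint δ (x ω)}},
      ∀ᶠ n in Filter.atTop, ω ∈ {ω | ε < (P.prod μ).real {e | (p.relax (hr n)).value (Set.range ω) <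
        (p.relax (hr n)).value (insert e (Set.range ω))}} := fun ω hω => by
    rw [Set.mem_preimage, Set.mem_ofPred_eq, ← hPμ] at hω
    refine eventually_lt_measureReal (fun e he => ?_) hω
    have hfst : Prod.fst '' Set.range ω = Set.range fun i => (ω i).1 := (Set.range_comp _ _).symm
    exact eventually_value_relax_lt_value_relax_insert hr tendsto_one_div_add_atTop_nhds_zero_nat
      (Set.finite_range ω) (hfst ▸ hx fun i => (ω i).1) (hfst ▸ hstrict hι _ e.1 he)
  obtain ⟨n, hn⟩ := (eventually_lt_measureReal hconverge hlt).exists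
  exact (measureReal_violation_relax_le (hr n) hL hmeas hF hcard hε).not_gt hn

end ConvexScenario

section FeasibleUnique

variable {d M : ℕ} {Δ : Type*} {X : Set (Dec d)} {f : Dec d → ℝ} {g : Fin M → Dec d → Δ → ℝ}
  {D D' : Fin M → Set Δ} {i : Fin M} {A : Set Δ} {x : Dec d} {δ : Δ}

theorem feasibleSet_anti (h : D ≤ D') : feasibleSet X g D' ⊆ feasibleSet X g D :=
  fun _ hx => ⟨hx.1, fun l δ hδ => hx.2 l δ (h l hδ)⟩

theorem mem_feasibleSet_update : x ∈ feasibleSet X g (Function.update D i A) ↔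
    (x ∈ X ∧ ∀ l ≠ i, ∀ δ ∈ D l, g l x δ ≤ 0) ∧ ∀ δ ∈ A, g i x δ ≤ 0 := by
  rw [feasibleSet, Set.mem_ofPred_eq,
    Function.forall_update_iff D fun l B => ∀ δ ∈ B, g l x δ ≤ 0, and_assoc,
    and_comm (b := ∀ δ ∈ A, _)]

theorem convex_feasibleSet_ne (hX : Convex ℝ X) (hg : ∀ i δ, ConvexOn ℝ X fun x => g i x δ)
    (i : Fin M) (D : Fin M → Set Δ) :
    Convex ℝ {x | x ∈ X ∧ ∀ l ≠ i, ∀ δ ∈ D l, g l x δ ≤ 0} :=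
  fun _ hx _ hy _ _ ha hb hab => ⟨hX hx.1 hy.1 ha hb hab, fun l hl δ hδ =>
    ((hg l δ).convex_le 0 ⟨hx.1, hx.2 l hl δ hδ⟩ ⟨hy.1, hy.2 l hl δ hδ⟩ ha hb hab).2⟩

namespace FeasibleUnique

theorem of_finite (h : FeasibleUnique X f g) (hD : ∀ l, (D l).Finite) (hne : (D i).Nonempty) :
    (interior (feasibleSet X g D)).Nonempty ∧ ∃! x, IsMinimizer X f g D x := by
  obtain ⟨n, δ, -, hrange⟩ := (Set.finite_iUnion hD).fin_param
  have hmem (l : Fin M) : D l ⊆ Set.range δ := hrange ▸ Set.subset_iUnion D l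
  obtain ⟨j, -⟩ := hmem i hne.some_mem
  exact (h n j.pos δ D hmem fun j => Set.mem_iUnion.1 (hrange ▸ Set.mem_range_self j)).2

theorem of_finite_update (h : FeasibleUnique X f g) (hD : ∀ l, (D l).Finite) (hA : A.Finite)
    (hne : A.Nonempty) :
    (interior (feasibleSet X g (Function.update D i A))).Nonempty ∧
      ∃! x, IsMinimizer X f g (Function.update D i A) x :=
  h.of_finite (i := i)
    ((Function.forall_update_iff D fun _ B => B.Finite).2 ⟨hA, fun l _ => hD l⟩)
    (by rwa [Function.update_self])

theorem exists_gt_of_violation (h : FeasibleUnique X f g) (hD : ∀ l, (D l).Finite)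
    {l : Fin M} (hne : (D l).Nonempty) (hx : IsMinimizer X f g D x) (hδ : 0 < g i x δ) :
    ∃ b, f x < b ∧ ∀ y ∈ feasibleSet X g (Function.update D i (insert δ (D i))), b ≤ f y := by
  obtain ⟨x', hx', -⟩ := (h.of_finite_update (i := i) hD ((hD i).insert δ)
    (Set.insert_nonempty δ _)).2
  have hx'δ : g i x' δ ≤ 0 := (mem_feasibleSet_update.1 hx'.1).2 δ (Set.mem_insert δ _)
  have hx'D : x' ∈ feasibleSet X g D :=
    feasibleSet_anti (le_update_self_iff.2 (Set.subset_insert δ (D i))) hx'.1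
  refine ⟨f x', (hx.2 x' hx'D).lt_of_ne fun heq => ?_, hx'.2⟩
  have hx'min : IsMinimizer X f g D x' := ⟨hx'D, fun y hy => heq ▸ hx.2 y hy⟩
  exact hx'δ.not_gt ((h.of_finite hD hne).2.unique hx hx'min ▸ hδ)

end FeasibleUnique

/-- The program in which only the scenarios of the `i`-th constraint vary, while the other
constraints are imposed at fixed finite sets of scenarios `D l`. The objective is made nonnegative
by exponentiation, which does not affect the minimizers. -/
noncomputable def singleConstraint [Nonempty Δ] (hX : Bornology.IsBounded X)
    (hf : ConvexOn ℝ X f) (hg : ∀ i δ, ConvexOn ℝ X fun x => g i x δ) (h : FeasibleUnique X f g)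
    (i : Fin M) (hD : ∀ l, (D l).Finite) : ConvexScenario (Dec d) Δ where
  domain := {x | x ∈ X ∧ ∀ l ≠ i, ∀ δ ∈ D l, g l x δ ≤ 0}
  cost x := Real.exp (f x)
  constraint δ x := g i x δ
  convexOn_cost :=
    ⟨convex_feasibleSet_ne hf.1 hg i D, fun _ hx _ hy _ _ ha hb hab =>
      (Real.exp_le_exp.2 (hf.2 hx.1 hy.1 ha hb hab)).trans
        (convexOn_exp.2 (Set.mem_univ _) (Set.mem_univ _) ha hb hab)⟩
  convexOn_constraint δ := (hg i δ).subset (fun _ hx => hx.1) (convex_feasibleSet_ne hf.1 hg i D)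
  cost_nonneg _ _ := (Real.exp_pos _).le
  isBounded_domain := hX.subset fun _ hx => hx.1
  slater A hA := by
    obtain ⟨δ⟩ := ‹Nonempty Δ›
    exact (h.of_finite_update hD (hA.insert δ) (Set.insert_nonempty δ A)).1.mono <|
      interior_mono fun x hx => mem_feasibleSet_update.1 <|
        feasibleSet_anti (Function.update_mono (Set.subset_insert δ A)) hx

theorem feasible_singleConstraint [Nonempty Δ] {hX : Bornology.IsBounded X}
    {hf : ConvexOn ℝ X f} {hg : ∀ i δ, ConvexOn ℝ X fun x => g i x δ} {h : FeasibleUnique X f g}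
    {hD : ∀ l, (D l).Finite} :
    (singleConstraint hX hf hg h i hD).feasible A = feasibleSet X g (Function.update D i A) :=
  Set.ext fun _ => mem_feasibleSet_update.symm

theorem exists_gt_cost_singleConstraint [Nonempty Δ] {hX : Bornology.IsBounded X}
    {hf : ConvexOn ℝ X f} {hg : ∀ i δ, ConvexOn ℝ X fun x => g i x δ} {h : FeasibleUnique X f g}
    {hD : ∀ l, (D l).Finite} (hA : A.Finite) (hne : A.Nonempty)
    (hx : IsMinimizer X f g (Function.update D i A) x) (hδ : 0 < g i x δ) :
    ∃ b, (singleConstraint hX hf hg h i hD).cost x < b ∧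
      ∀ y ∈ (singleConstraint hX hf hg h i hD).feasible (insert δ A),
        b ≤ (singleConstraint hX hf hg h i hD).cost y := by
  obtain ⟨b, hb, hle⟩ := h.exists_gt_of_violation
    ((Function.forall_update_iff D fun _ B => B.Finite).2 ⟨hA, fun l _ => hD l⟩)
    (l := i) (by rwa [Function.update_self]) hx hδ
  rw [Function.update_self, Function.update_idem] at hle
  exact ⟨Real.exp b, Real.exp_lt_exp.2 hb, fun y hy =>
    Real.exp_le_exp.2 (hle y (feasible_singleConstraint.subset hy))⟩

theorem starProjection_span_constraintDomain {V : Submodule ℝ (Dec d)} (hx : x ∈ X) :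
    (Submodule.span ℝ (constraintDomain X V)).starProjection x = V.starProjection x := by
  have hle : Submodule.span ℝ (constraintDomain X V) ≤ V :=
    Submodule.span_le.2 <| Set.image_subset_iff.2 fun y _ => V.starProjection_apply_mem y
  exact Submodule.eq_starProjection_of_mem_orthogonal
    (Submodule.subset_span (Set.mem_image_of_mem _ hx))
    (Submodule.orthogonal_le hle (V.sub_starProjection_mem_orthogonal x))

end FeasibleUnique

section Conditioning

theorem measureReal_pi_le_of_forall_updateFinset {Δ ι : Type*} [MeasurableSpace Δ]
    {P : Measure Δ} [IsProbabilityMeasure P] [Fintype ι] [DecidableEq ι] {s : Set (ι → Δ)}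
    (hs : MeasurableSet s) (I : Finset ι) {c : ℝ}
    (h : ∀ ω, (Measure.pi fun _ : I => P).real {w | Function.updateFinset ω I w ∈ s} ≤ c) :
    (Measure.pi fun _ : ι => P).real s ≤ c := by
  obtain ⟨δ⟩ := nonempty_of_isProbabilityMeasure P
  have hc : 0 ≤ c := measureReal_nonneg.trans (h fun _ => δ)
  have hslice (ω : ι → Δ) :
      (lmarginal (fun _ => P) I (s.indicator 1)) ω ≤ ENNReal.ofReal c := by
    refine le_of_eq_of_le (lintegral_indicator_one (measurable_updateFinset hs)) ?_
    exact (ENNReal.le_ofReal_iff_toReal_le (measure_ne_top _ _) hc).2 (h ω)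
  refine ENNReal.toReal_le_of_le_ofReal hc ?_
  calc Measure.pi (fun _ => P) s
      = lmarginal (fun _ => P) Iᶜ (lmarginal (fun _ => P) I (s.indicator 1)) fun _ => δ := by
        rw [← lmarginal_union _ _ (measurable_one.indicator hs) disjoint_compl_left,
          Finset.union_comm, Finset.union_compl, ← lintegral_eq_lmarginal_univ,
          lintegral_indicator_one hs]
    _ ≤ lmarginal (fun _ => P) Iᶜ (fun _ => ENNReal.ofReal c) fun _ => δ :=
        lmarginal_mono hslice _
    _ = ENNReal.ofReal c := by rw [lmarginal, lintegral_const, measure_univ, mul_one]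

theorem updateFinset_image_eq_update {Δ ι κ : Type*} [DecidableEq ι] [DecidableEq κ]
    {J : κ → Finset ι} (hJ : Pairwise (Function.onFun Disjoint J)) (i : κ) (ω : ι → Δ)
    (w : J i → Δ) :
    (fun l => Function.updateFinset ω (J i) w '' (J l : Set ι)) =
      Function.update (fun l => ω '' (J l : Set ι)) i (Set.range w) := by
  refine Function.eq_update_iff.2 ⟨?_, fun l hl => Set.image_congr fun j hj => ?_⟩
  · rw [Set.image_eq_range]
    exact congrArg Set.range <| funext fun j => dif_pos j.2
  · exact dif_neg (Finset.disjoint_left.1 (hJ hl) hj)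

end Conditioning

section Violation

variable {d M : ℕ} {Δ : Type*} [MeasurableSpace Δ] {P : Measure Δ} [IsProbabilityMeasure P]
  {X : Set (Dec d)} {f : Dec d → ℝ} {g : Fin M → Dec d → Δ → ℝ}

theorem measurableSet_violation {Ω : Type*} [MeasurableSpace Ω] {h : Dec d → Δ → ℝ}
    (hh : Measurable fun q : X × Δ => h q.1 q.2) {x : Ω → Dec d} (hx : Measurable x)
    (hxX : ∀ ω, x ω ∈ X) (c : ℝ) : MeasurableSet {ω | c < P.real {δ | 0 < h (x ω) δ}} := by
  have hjoint : Measurable fun q : Ω × Δ => h (x q.1) q.2 :=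
    hh.comp (((hx.comp measurable_fst).subtype_mk (h := fun q => hxX q.1)).prodMk measurable_snd)
  exact measurableSet_lt measurable_const
    (measurable_measure_prodMk_left (measurableSet_lt measurable_const hjoint)).ennreal_toReal

theorem measureReal_single_violation_le (hX : Bornology.IsBounded X) (hf : ConvexOn ℝ X f)
    (hgconvex : ∀ i δ, ConvexOn ℝ X fun x => g i x δ)
    (hgmeas : ∀ i, Measurable fun q : X × Δ => g i q.1 q.2) (hassum : FeasibleUnique X f g)
    {i : Fin M} {V : Submodule ℝ (Dec d)} (hV : DependsOnlyOn X V (g i))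
    {ι : Type} [Fintype ι] {J : Fin M → Finset ι} (hJ : Pairwise (Function.onFun Disjoint J))
    (hcard : setDim (constraintDomain X V) ≤ (J i).card) {ε : ℝ} (hε : ε ∈ Set.Icc 0 1)
    {x : (ι → Δ) → Dec d} (hxmeas : Measurable x)
    (hxmin : ∀ ω, IsMinimizer X f g (fun l => ω '' (J l : Set ι)) (x ω)) :
    (Measure.pi fun _ : ι => P).real {ω | ε < P.real {δ | 0 < g i (x ω) δ}} ≤
      (binomialTail (J i).card (setDim (constraintDomain X V))).eval ε := by
  classical
  have := nonempty_of_isProbabilityMeasure P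
  refine measureReal_pi_le_of_forall_updateFinset
    (measurableSet_violation (hgmeas i) hxmeas (fun ω => (hxmin ω).1.1) ε) (J i) fun ω => ?_
  let W := Submodule.span ℝ (constraintDomain X V)
  have hfin (ω : ι → Δ) (l : Fin M) : (ω '' (J l : Set ι)).Finite := Set.toFinite _
  let p := singleConstraint hX hf hgconvex hassum i (hfin ω)
  have hL (δ) : ∀ y ∈ p.domain, ∀ z ∈ p.domain, W.orthogonalProjectionOnto y =
      W.orthogonalProjectionOnto z → p.constraint δ y = p.constraint δ z := fun y hy z hz hyz => by
    refine hV y hy.1 z hz.1 ?_ δ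
    rw [← starProjection_span_constraintDomain hy.1, ← starProjection_span_constraintDomain hz.1]
    exact congrArg Subtype.val hyz
  have hmin (w : J i → Δ) := hxmin (Function.updateFinset ω (J i) w)
  simp only [updateFinset_image_eq_update hJ] at hmin
  have hfeas (w : J i → Δ) : x (Function.updateFinset ω (J i) w) ∈ p.feasible (Set.range w) := by
    rw [feasible_singleConstraint]
    exact (hmin w).1
  have hbound := ConvexScenario.measureReal_violation_le (P := P) (p := p)
    (L := W.orthogonalProjectionOnto.toLinearMap) (ι := J i) hL (fun y hy =>
      (hgmeas i).comp (measurable_prodMk_left (x := (⟨y, hy.1⟩ : X))))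
    ((Fintype.card_coe (J i)).symm ▸ hcard) hε hfeas fun _ w δ hδ =>
      exists_gt_cost_singleConstraint (Set.finite_range w) (Set.range_nonempty w) (hmin w) hδ
  rwa [Fintype.card_coe] at hbound

theorem chanceConstraint_jointConstraint_of_forall [NeZero M] {εs : Fin M → ℝ} {x : Dec d}
    (h : ∀ i, P.real {δ | 0 < g i x δ} ≤ εs i) :
    ChanceConstraint P (jointConstraint g) (∑ i, εs i) x := by
  have hunion : {δ | 0 < jointConstraint g x δ} = ⋃ i, {δ | 0 < g i x δ} := by
    ext δ
    simp [jointConstraint, Finset.lt_sup'_iff]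
  rw [ChanceConstraint, hunion, ← ofReal_measureReal]
  refine ENNReal.ofReal_le_ofReal ?_
  exact (measureReal_iUnion_fintype_le _).trans (Finset.sum_le_sum fun i _ => h i)

theorem ofReal_one_sub_sum_le_measure {Ω κ : Type*} [Fintype κ] [MeasurableSpace Ω]
    {Q : Measure Ω} [IsProbabilityMeasure Q] {s : κ → Set Ω} {t : Set Ω} {b : κ → ℝ}
    (hs : ∀ i, MeasurableSet (s i)) (hst : (⋃ i, s i)ᶜ ⊆ t) (hb : ∀ i, Q.real (s i) ≤ b i) :
    ENNReal.ofReal (1 - ∑ i, b i) ≤ Q t := by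
  refine (ENNReal.ofReal_le_of_le_toReal ?_).trans (measure_mono hst)
  rw [← measureReal_def, probReal_compl_eq_one_sub (MeasurableSet.iUnion hs)]
  gcongr
  exact (measureReal_iUnion_fintype_le _).trans (Finset.sum_le_sum fun i _ => hb i)

end Violation

theorem pairwise_disjoint_of_sum_card {ι κ : Type*} [Fintype ι] [Fintype κ] {J : κ → Finset ι}
    (hcover : ∀ j, ∃ i, j ∈ J i) (hcard : ∑ i, (J i).card = Fintype.card ι) :
    Pairwise (Function.onFun Disjoint J) := by
  have hsurj : Function.Surjective fun a : Σ i, J i => (a.2 : ι) := fun j =>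
    let ⟨i, hi⟩ := hcover j
    ⟨⟨i, j, hi⟩, rfl⟩
  have hinj : Function.Injective fun a : Σ i, J i => (a.2 : ι) :=
    ((Fintype.bijective_iff_surjective_and_card _).2 ⟨hsurj, by simpa using hcard⟩).1
  exact fun i l hil => Finset.disjoint_left.2 fun j hi hl =>
    hil (congrArg Sigma.fst (@hinj ⟨i, j, hi⟩ ⟨l, j, hl⟩ rfl))

theorem mainTheorem2_general {d M : ℕ} [NeZero M] {Δ : Type*} [MeasurableSpace Δ] {P : Measure Δ}
    [IsProbabilityMeasure P] {X : Set (Dec d)} (hX : Bornology.IsBounded X) {f : Dec d → ℝ}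
    (hf : ConvexOn ℝ X f) {g : Fin M → Dec d → Δ → ℝ}
    (hgconvex : ∀ i δ, ConvexOn ℝ X fun x => g i x δ)
    (hgmeas : ∀ i, Measurable fun q : X × Δ => g i q.1 q.2) (hassum : FeasibleUnique X f g)
    {V : Fin M → Submodule ℝ (Dec d)} (hV : ∀ i, DependsOnlyOn X (V i) (g i))
    {εs βs : Fin M → ℝ} (hεs : ∀ i, εs i ∈ Set.Ioo 0 1) (hβs : ∀ i, βs i ∈ Set.Ioo 0 1)
    {ι : Type} [Fintype ι] {J : Fin M → Finset ι} (hJ : Pairwise (Function.onFun Disjoint J))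
    (hcard : ∀ i, sampleSize (εs i) (βs i) (setDim (constraintDomain X (V i))) ≤ (J i).card)
    {x : (ι → Δ) → Dec d} (hxmeas : Measurable x)
    (hxmin : ∀ ω, IsMinimizer X f g (fun i => ω '' (J i : Set ι)) (x ω)) :
    ENNReal.ofReal (1 - ∑ i, βs i) ≤ Measure.pi (fun _ : ι => P)
      {ω | ChanceConstraint P (jointConstraint g) (∑ i, εs i) (x ω)} := by
  refine ofReal_one_sub_sum_le_measure
    (s := fun i => {ω | εs i < P.real {δ | 0 < g i (x ω) δ}})
    (fun i => measurableSet_violation (hgmeas i) hxmeas (fun ω => (hxmin ω).1.1) _)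
    (fun ω hω => chanceConstraint_jointConstraint_of_forall fun i =>
      not_lt.1 fun hi => hω (Set.mem_iUnion.2 ⟨i, hi⟩)) fun i => ?_
  exact (measureReal_single_violation_le hX hf hgconvex hgmeas hassum (hV i) hJ
    (le_of_sampleSize_le (hεs i) (hβs i) (hcard i)) (Set.Ioo_subset_Icc_self (hεs i)) hxmeas
    hxmin).trans (eval_binomialTail_le_of_sampleSize_le (hεs i) (hβs i).1 (hcard i))

end ScenarioProgram

theorem mainTheorem2 {d M : ℕ} [NeZero M]
    {Δ : Type*} [MeasurableSpace Δ] (P : MeasureTheory.Measure Δ)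
    [MeasureTheory.IsProbabilityMeasure P]
    (X : Set (ScenarioProgram.Dec d)) (hXcompact : IsCompact X) (hXconvex : Convex ℝ X)
    (f : ScenarioProgram.Dec d → ℝ) (hf : ConvexOn ℝ X f)
    (g : Fin M → ScenarioProgram.Dec d → Δ → ℝ)
    (hgconvex : ∀ i δ, ConvexOn ℝ X (fun x => g i x δ))
    (hgmeas : ∀ i, Measurable (fun p : X × Δ => g i (p.1 : ScenarioProgram.Dec d) p.2))
    (hassum : ScenarioProgram.FeasibleUnique X f g)
    -- the i-th constraint involves only the part of the decision vector in `V i`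
    (V : Fin M → Submodule ℝ (ScenarioProgram.Dec d))
    (hV : ∀ i, ScenarioProgram.DependsOnlyOn X (V i) (g i))
    -- violation and confidence levels
    (ε β : ℝ) (hε : ε ∈ Set.Ioo (0 : ℝ) 1) (hβ : β ∈ Set.Ioo (0 : ℝ) 1)
    (εs βs : Fin M → ℝ) (hεs : ∀ i, εs i ∈ Set.Ioo (0 : ℝ) 1)
    (hβs : ∀ i, βs i ∈ Set.Ioo (0 : ℝ) 1)
    (hεsum : ∑ i, εs i = ε) (hβsum : ∑ i, βs i = β)
    -- sample sizes, and the assignment of the `∑ i, S i` samples to the constraints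
    (S : Fin M → ℕ)
    (hS : ∀ i, ScenarioProgram.sampleSize (εs i) (βs i)
      (ScenarioProgram.setDim (ScenarioProgram.constraintDomain X (V i))) ≤ S i)
    (J : Fin M → Finset (Fin (∑ i, S i)))
    (hJcard : ∀ i, (J i).card = S i) (hJcover : ∀ j, ∃ i, j ∈ J i)
    -- the minimizer of the scenario program, as a measurable function of the samples
    (xstar : (Fin (∑ i, S i) → Δ) → ScenarioProgram.Dec d) (hxmeas : Measurable xstar)
    (hxmin : ∀ ω : Fin (∑ i, S i) → Δ,
      ScenarioProgram.IsMinimizer X f g (fun i => ω '' (J i : Set (Fin (∑ i, S i)))) (xstar ω)) :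
    ENNReal.ofReal (1 - β) ≤
      MeasureTheory.Measure.pi (fun _ : Fin (∑ i, S i) => P)
        {ω | ScenarioProgram.ChanceConstraint P (ScenarioProgram.jointConstraint g) ε
          (xstar ω)} := by
  subst hεsum hβsum
  exact ScenarioProgram.mainTheorem2_general hXcompact.isBounded hf hgconvex hgmeas hassum hV hεs
    hβs (ScenarioProgram.pairwise_disjoint_of_sum_card hJcover (by simp [hJcard]))
    (fun i => (hS i).trans_eq (hJcard i).symm) hxmeas hxmin
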